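/- **Setting.** Let $\mathsf{Pids}$ be a set of process indices; each process $i$ owns a set $AP_i$ of atomic propositions, and an $i$-state is a truth assignment to $AP_i$. For every unordered pair $\{i,j\}$, $i\ne j$, there is a set $SH_{ij}$ of shared variables (disjoint for different pairs). A *pair-program* for $\{i,j\}$ consists of a set $S^0_{ij}$ of initial states and of two synchronization skeletons $P_i^j$, $P_j^i$: directed graphs on $i$-states, resp. $j$-states, without dead ends, with at most one arc from a node to a node, each arc labelled by a finite disjunction of guarded commands $B_\ell\to A_\ell$, where $B_\ell$ is a predicate on pair-states ($i$-state, $j$-state, values of $SH_{ij}$) and $A_\ell$ is a parallel assignment to $SH_{ij}$. Its interleaving semantics is the transition structure $M_{ij}$. Formulae are those of ACTL without nexttime, built from true, false, $p$, $\neg p$, $\wedge$, $\vee$, $A[f\,U\,g]$, $A[f\,U_w\,g]$ with path quantifiers over fullpaths (maximal, finite or infinite, paths); $AFf=A[\mathit{true}\,U f]$; $CL(f)$ is the set of subformulae of $f$ including $f$; $M\models_\Phi f$ is satisfaction with path quantifiers restricted to fullpaths satisfying $\Phi$. A *dynamic specification* consists of a set $\mathcal{UI}$ of pair-specifications $\langle\{i,j\},spec_{ij}\rangle$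 ($i \neq j$, $spec_{ij}$ a formula over $AP_i\cup AP_j$), a finite set $\mathcal I_0\subseteq\mathcal{UI}$ and a map $create:2^{\mathcal{UI}}\to 2^{\mathcal{UI}}$; for each pair, a set of available pair-programs is given. A *configuration* $s$ consists of the set $s.\mathcal I\subseteq\mathcal{UI}$ of specifications in force and, for each pair $\{i,j\}$ occurring in it, an active pair-program and its current state $s{\upharpoonright}ij$, such that these states agree on the local state $s{\upharpoonright}i$ of each common process. $\mathrm{pairs}(s)$ and $\mathrm{procs}(s)$ are the pairs and processes occurring in $s.\mathcal I$. *The synthesized program, $M_{\mathcal P}$.* Initially $\mathcal I_0$ is in force, with available pair-programs that satisfy their specifications, in initial states. In a normal transition by $i\in \mathrm{procs}(s)$, process $i$ changes its local state from $a$ to $b$ such that, for every neighbour $j$, $P_i^j$ has an arc from $a$ to $b$ with a guarded command that is true in $s{\upharpoonright}ij$ and whose assignment is executed; all else is unchanged. A create transition adds some $\langle\{i,j\},spec_{ij}\rangle\in create(s.\mathcal I)$ with $\{i,j\}\notin\mathrm{pairs}(s)$, together with an available pair-program satisfying $spec_{ij}$, in a reachable state of that program that agrees with the current local states of $i$ and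 $j$ if they exist; all else is unchanged. *Wait-for-graph.* The moves of $P_i$ in $s$ are the $(a,b)$ with $a=s{\upharpoonright}i$ such that $P_i^j$ has an arc from $a$ to $b$ for all neighbours $j$ of $i$. $W(s)$ is the directed graph whose nodes are the processes of $s$ and their moves, with an edge from each process to each of its moves, and an edge from a move of $i$ to a neighbour $j$ iff all guards of that arc in $P_i^j$ are false in $s{\upharpoonright}ij$. A *supercycle* is a nonempty subgraph of $W(s)$ that contains, with each process, the edges to all its moves, and, with each move, at least one outgoing edge of that move in $W(s)$. *Implementation $M_r$.* A configuration $u$ of $M_r$ consists of a configuration as above, a control state of each process, and the locks held. Each existing process $i$ repeats: (1) it polls guards of its moves one at a time (one guard per atomic step, in any order), recording for each move and neighbour $j$ the first guard found true, until for some move a true guard has been found for every neighbour; (2) that move is returned and the process requests locks on $AP_i$ and on all variables assigned by the chosen assignments, which are granted when no other process holds a lock on any of them (the interface of dining/drinking philosophers); (3) without re-evaluating guards, in one atomic step, it executes the chosen assignments and changes its local state; (4) it releases all locks. A create transition is as in $M_{\mathcal P}$, and can occur only while those of the two processes that already exist are between two such rounds. Initially the configuration is an initial configuration of $M_{\mathcal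 P}$, every process is between rounds and no lock is held. *Fairness.* A fullpath $\rho$ of $M_r$ satisfies $\Phi$ iff, with $ex_i$ true along exactly the transitions that execute a move of $i$ (step 3): (a) for every process $i$ occurring along $\rho$, if from some point on $i$ always has an enabled arc (a move all of whose guard conjuncts are true) and always is in a local state that is sometimes-blocking (for some neighbour $j$, in some reachable state of $M_{ij}$ with that local state of $i$, some arc of $P_j^i$ from the local state of $j$ has all guards false), then $ex_i$ infinitely often; (b) for every pair $\{i,j\}$ occurring along $\rho$, if from some point on $i$ always has an enabled arc, or from some point on $j$ always has an enabled arc, and from some point on $pnd_{ij}$ always holds, then $ex_i\vee ex_j$ infinitely often; (c) infinitely many transitions of $\rho$ are not create transitions. Here $pnd_{ij}$ holds in $s$ iff there is an $f\in CL(spec_{ij})$, $spec_{ij}$ being in force in $s$, with $M_{ij},s{\upharpoonright}ij\models\neg f\wedge AFf$. *Standing assumptions.* In every reachable configuration of $M_{\mathcal P}$, active pair-programs with a common process $i$ give $i$ the same unlabelled graph, and all guards of the active pair-programs are temporarily stable: for every guard $B$ on an arc of $P_i^j$ with start state $a$, from every reachable state of $M_{ij}$ in which $i$ is in $a$ and $B$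 is true, along every fullpath this remains so unless and until the local state of $i$ differs from $a$. *Liveness condition.* For every reachable configuration $s$ of $M_{\mathcal P}$ and $\{i,j\}\in\mathrm{pairs}(s)$: (i) along every infinite path of $M_{ij}$ that starts in a reachable state and all of whose transitions are by $i$, from some point on all arcs of $P_j^i$ from the current local state of $j$ are enabled, and likewise with $i$ and $j$ exchanged; (ii) if $pnd_{ij}$ holds in $s$, there is a finite $W\subseteq\mathsf{Pids}$ such that, for all $t$ reachable from $s$ in $M_{\mathcal P}$ along paths on which $pnd_{ij}$ holds throughout, every process to which there is a path in $W(t)$ from $i$ or $j$ is in $W$. **Theorem (Large model theorem for the low-atomicity implementation).** Under the standing assumptions, let $i,j\in\mathsf{Pids}$ and let $u$ be a reachable configuration of $M_r$ with $\langle\{i,j\},spec_{ij}\rangle\in u.\mathcal I$, where $spec_{ij}$ is a nexttime-free ACTL formula over $AP_i\cup AP_j$. Suppose that 1. the liveness condition holds, 2. $W(v)$ is supercycle-free for every reachable configuration $v$ of $M_r$, and 3. $M_{ij},u{\upharpoonright}ij\models f_{ij}$, where $f_{ij}\in CL(spec_{ij})$. Then $M_r,u\models_\Phi f_{ij}$.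 -/

import Mathlib

namespace DynSynth

/-! ### Paths of labelled transition relations, ACTL without nexttime -/

/-- A finite or infinite sequence `st 0 --lab 0--> st 1 --lab 1--> ...` with `len` transitions
(`len = ⊤` for an infinite sequence).  Values of `st` beyond `len`, and of `lab` from `len` on,
are irrelevant. -/
structure Path (S L : Type*) where
  len : ℕ∞
  st : ℕ → S
  lab : ℕ → L

namespace Path

variable {S L : Type*}

/-- `π` is a fullpath (a maximal path) of the transition relation `tr`. -/
def IsFull (tr : S → L → S → Prop) (π : Path S L) : Prop :=
  (∀ n : ℕ, (n : ℕ∞) < π.len → tr (π.st n) (π.lab n) (π.st (n + 1))) ∧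
  (∀ n : ℕ, π.len = n → ¬ ∃ l t, tr (π.st n) l t)

/-- `π ⊨ [f U g]`. -/
def Until (π : Path S L) (f g : S → Prop) : Prop :=
  ∃ n : ℕ, (n : ℕ∞) ≤ π.len ∧ g (π.st n) ∧ ∀ m < n, f (π.st m)

/-- `π ⊨ [f Uw g]` (weak until). -/
def WeakUntil (π : Path S L) (f g : S → Prop) : Prop :=
  ∀ n : ℕ, (n : ℕ∞) ≤ π.len → (∀ m ≤ n, ¬ g (π.st m)) → f (π.st n)

/-- Eventually always, for an assertion on states. -/
def EvAlways (π : Path S L) (q : S → Prop) : Prop :=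
  ∃ n : ℕ, (n : ℕ∞) ≤ π.len ∧ ∀ m : ℕ, n ≤ m → (m : ℕ∞) ≤ π.len → q (π.st m)

/-- Infinitely often, for an assertion on transitions (given through their labels). -/
def InfOften (π : Path S L) (q : L → Prop) : Prop :=
  ∀ n : ℕ, ∃ m : ℕ, n ≤ m ∧ (m : ℕ∞) < π.len ∧ q (π.lab m)

end Path

/-- `s` is reachable from the set `S0` along `tr`. -/
def ReachableFrom {S L : Type*} (tr : S → L → S → Prop) (S0 : Set S) (s : S) : Prop :=
  ∃ s0 ∈ S0, Relation.ReflTransGen (fun a b => ∃ l, tr a l b) s0 s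

/-- Formulae of ACTL without the nexttime modality, over the atomic propositions `α`. -/
inductive ACTL (α : Type*) where
  | tt : ACTL α
  | ff : ACTL α
  | atom : α → ACTL α
  | natom : α → ACTL α
  | and : ACTL α → ACTL α → ACTL α
  | or : ACTL α → ACTL α → ACTL α
  | AU : ACTL α → ACTL α → ACTL α
  | AUw : ACTL α → ACTL α → ACTL α

namespace ACTL

variable {α : Type*}

/-- `A F f = A[true U f]`. -/
def AF (f : ACTL α) : ACTL α := AU tt f

/-- The set of all subformulae, including the formula itself. -/
def CL : ACTL α → Set (ACTL α)
  | tt => {tt}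
  | ff => {ff}
  | atom a => {atom a}
  | natom a => {natom a}
  | and f g => insert (and f g) (CL f ∪ CL g)
  | or f g => insert (or f g) (CL f ∪ CL g)
  | AU f g => insert (AU f g) (CL f ∪ CL g)
  | AUw f g => insert (AUw f g) (CL f ∪ CL g)

/-- Satisfaction at a state, where path quantification ranges over the fullpaths of `tr` that
satisfy `fair`; `val s a` says that the proposition `a` is true in `s`. -/
def Sat {S L : Type*} (tr : S → L → S → Prop) (fair : Path S L → Prop) (val : S → α → Prop) :
    ACTL α → S → Prop
  | tt, _ => True
  | ff, _ => False
  | atom a, s => val s a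
  | natom a, s => ¬ val s a
  | and f g, s => Sat tr fair val f s ∧ Sat tr fair val g s
  | or f g, s => Sat tr fair val f s ∨ Sat tr fair val g s
  | AU f g, s => ∀ π : Path S L, π.IsFull tr → π.st 0 = s → fair π →
      π.Until (Sat tr fair val f) (Sat tr fair val g)
  | AUw f g, s => ∀ π : Path S L, π.IsFull tr → π.st 0 = s → fair π →
      π.WeakUntil (Sat tr fair val f) (Sat tr fair val g)

end ACTL

/-! ### Pair-programs in the synchronization skeleton notation -/

/-- The vocabulary: process indices, the atomic propositions owned by each process, and for
each unordered pair of processes its shared variables with their domains.  (Indexing by the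
pair makes the variable sets of different pairs disjoint.) -/
structure Sig where
  Pid : Type*
  AP : Pid → Type*
  Sh : Sym2 Pid → Type*
  Dom : (e : Sym2 Pid) → Sh e → Type*

variable {G : Sig}

/-- An `i`-state: a truth assignment to the propositions of process `i`. -/
abbrev LState (G : Sig) (i : G.Pid) := G.AP i → Bool

/-- Values of all variables shared by the pair `e`. -/
abbrev Valuation (G : Sig) (e : Sym2 G.Pid) := (x : G.Sh e) → G.Dom e x

/-- A global state of a pair-program for `e = {i, j}`: an `i`-state, a `j`-state and values
for the shared variables. -/
structure PairState (G : Sig) (e : Sym2 G.Pid) where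
  loc : (p : G.Pid) → p ∈ e → LState G p
  sh : Valuation G e

/-- The atomic propositions `AP_i ∪ AP_j` for `e = {i, j}`. -/
abbrev PairAtom (G : Sig) (e : Sym2 G.Pid) := (p : {p : G.Pid // p ∈ e}) × G.AP p.1

/-- The proposition is true in the pair-state. -/
def PairState.val {e : Sym2 G.Pid} (s : PairState G e) (a : PairAtom G e) : Prop :=
  s.loc a.1.1 a.1.2 a.2 = true

/-- A parallel assignment to shared variables: for each variable either no assignment or
a right-hand side. -/
abbrev Assign (G : Sig) (e : Sym2 G.Pid) :=
  (x : G.Sh e) → Option (Valuation G e → G.Dom e x)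

/-- The shared variables after executing the parallel assignment. -/
def Assign.exec {e : Sym2 G.Pid} (A : Assign G e) (v : Valuation G e) : Valuation G e :=
  fun x => match A x with
    | none => v x
    | some r => r v

/-- A guarded command `guard → body`. -/
structure GCmd (G : Sig) (e : Sym2 G.Pid) where
  guard : PairState G e → Prop
  body : Assign G e

/-- A pair-program for the pair `e`: for each of its processes `p` a synchronization skeleton,
that is a directed graph on local states, with at most one arc from `s` to `t`, whose arcs are
labelled by finite disjunctions of guarded commands and which has no dead ends; and a set of
initial states. -/
structure PairProgram (G : Sig) (e : Sym2 G.Pid) where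
  node : (p : G.Pid) → p ∈ e → Set (LState G p)
  arc : (p : G.Pid) → p ∈ e → LState G p → LState G p → Option (List (GCmd G e))
  arc_mem : ∀ p hp s t L, arc p hp s t = some L → s ∈ node p hp ∧ t ∈ node p hp
  exists_arc : ∀ p hp, ∀ s ∈ node p hp, ∃ t L, arc p hp s t = some L
  start : Set (PairState G e)
  start_mem : ∀ s ∈ start, ∀ p hp, s.loc p hp ∈ node p hp

namespace PairProgram

variable {e : Sym2 G.Pid}

/-- The transitions of the pair-program executing in isolation (the pair-structure `M_ij`). -/
def Trans (P : PairProgram G e) (s : PairState G e) (h : G.Pid) (t : PairState G e) : Prop :=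
  ∃ hh : h ∈ e,
    (∃ L, P.arc h hh (s.loc h hh) (t.loc h hh) = some L ∧
      ∃ g ∈ L, g.guard s ∧ t.sh = g.body.exec s.sh) ∧
    ∀ q hq, q ≠ h → t.loc q hq = s.loc q hq

/-- Reachable states of `M_ij`. -/
def Reachable (P : PairProgram G e) (s : PairState G e) : Prop :=
  ReachableFrom P.Trans P.start s

/-- `M_ij, s ⊨ f`. -/
def Sat (P : PairProgram G e) (s : PairState G e) (f : ACTL (PairAtom G e)) : Prop :=
  f.Sat P.Trans (fun _ => True) PairState.val s

/-- The pair-program satisfies the specification: `M_ij, S⁰_ij ⊨ f`. -/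
def Models (P : PairProgram G e) (f : ACTL (PairAtom G e)) : Prop :=
  ∀ s ∈ P.start, P.Sat s f

/-- `s` has a pending eventuality with respect to the specification `spec`. -/
def Pending (P : PairProgram G e) (spec : ACTL (PairAtom G e)) (s : PairState G e) : Prop :=
  ∃ f ∈ spec.CL, ¬ P.Sat s f ∧ P.Sat s f.AF

/-- The local state `a` of process `p` is sometimes-blocking in `M_pq`: in some reachable state
where `p` is in `a`, some arc of the other process, at its start state, has a false guard. -/
def SometimesBlocking (P : PairProgram G e) (p : G.Pid) (hp : p ∈ e) (a : LState G p) : Prop :=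
  ∃ s, P.Reachable s ∧ s.loc p hp = a ∧
    ∃ q hq, q ≠ p ∧ ∃ b L, P.arc q hq (s.loc q hq) b = some L ∧ ∀ g ∈ L, ¬ g.guard s

/-- `aen_q`: every arc of `q` whose start is the current local state of `q` is enabled. -/
def AllEnabled (P : PairProgram G e) (q : G.Pid) (hq : q ∈ e) (s : PairState G e) : Prop :=
  ∀ b L, P.arc q hq (s.loc q hq) b = some L → ∃ g ∈ L, g.guard s

/-- `M_pq, S⁰ ⊨ AG A(G ex_p ⇒ eventually always aen_q)`, for both choices of `p` in the pair.
A path satisfies `G ex_p` if at each of its states there is a next transition and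
it is by `p`. -/
def LocalLiveness (P : PairProgram G e) : Prop :=
  ∀ p ∈ e, ∀ q, ∀ hq : q ∈ e, q ≠ p → ∀ s, P.Reachable s →
    ∀ π : Path (PairState G e) G.Pid, π.IsFull P.Trans → π.st 0 = s →
      (∀ n : ℕ, (n : ℕ∞) ≤ π.len → (n : ℕ∞) < π.len ∧ π.lab n = p) →
      π.EvAlways (P.AllEnabled q hq)

/-- All guards are temporarily stable: for every arc from `a` to `b` of a process `p` and every
guard `B` in its label, `M, S⁰ ⊨ AG(({a} ∧ B) ⇒ A[({a} ∧ B) Uw ¬{a}])`. -/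
def TemporarilyStable (P : PairProgram G e) : Prop :=
  ∀ p, ∀ hp : p ∈ e, ∀ a b L, P.arc p hp a b = some L → ∀ g ∈ L,
    ∀ s, P.Reachable s → s.loc p hp = a ∧ g.guard s →
      ∀ π : Path (PairState G e) G.Pid, π.IsFull P.Trans → π.st 0 = s →
        π.WeakUntil (fun t => t.loc p hp = a ∧ g.guard t) (fun t => ¬ t.loc p hp = a)

end PairProgram

/-! ### Dynamic specifications, configurations, and the synthesized program -/

/-- A pair-specification `⟨{i, j}, spec_ij⟩`. -/
structure PairSpec (G : Sig) where
  pair : Sym2 G.Pid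
  spec : ACTL (PairAtom G pair)

/-- The pairs mentioned in a set of pair-specifications. -/
def pairsOf (I : Set (PairSpec G)) : Set (Sym2 G.Pid) := {e | ∃ σ ∈ I, σ.pair = e}

/-- A dynamic specification (universal set, finite initial set, creation rule), with, for each
pair, the set of pair-programs that the pair-synthesis step supplies for it. -/
structure DynSpec (G : Sig) where
  univ : Set (PairSpec G)
  univ_ne : ∀ σ ∈ univ, ¬ σ.pair.IsDiag
  initial : Set (PairSpec G)
  initial_sub : initial ⊆ univ
  initial_finite : initial.Finite
  create : Set (PairSpec G) → Set (PairSpec G)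
  create_sub : ∀ I ⊆ univ, create I ⊆ univ
  supply : (e : Sym2 G.Pid) → Set (PairProgram G e)

/-- A (consistent) configuration: the pair-specifications in force and, for each of their
pairs, the active pair-program and its current state. -/
structure Config (G : Sig) where
  inForce : Set (PairSpec G)
  prog : (e : Sym2 G.Pid) → e ∈ pairsOf inForce → PairProgram G e
  state : (e : Sym2 G.Pid) → e ∈ pairsOf inForce → PairState G e
  consistent : ∀ e he e' he' p (hp : p ∈ e) (hp' : p ∈ e'),
    (state e he).loc p hp = (state e' he').loc p hp'

namespace Config

/-- The active pairs. -/
def pairs (c : Config G) : Set (Sym2 G.Pid) := pairsOf c.inForce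

/-- The processes that have been created. -/
def procs (c : Config G) : Set G.Pid := {i | ∃ e ∈ c.pairs, i ∈ e}

/-- The pairs of which `i` is a member; these correspond to the neighbours of `i`. -/
def nbrs (c : Config G) (i : G.Pid) : Set (Sym2 G.Pid) := {e | e ∈ c.pairs ∧ i ∈ e}

/-- `i` exists and its local state `c ↾ i` is `a`. -/
def LocalIs (c : Config G) (i : G.Pid) (a : LState G i) : Prop :=
  ∃ e, ∃ he : e ∈ c.pairs, ∃ hi : i ∈ e, (c.state e he).loc i hi = a

/-- The proposition `a` of process `i` is true in `c`. -/
def Holds (c : Config G) (i : G.Pid) (a : G.AP i) : Prop :=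
  ∃ s, c.LocalIs i s ∧ s a = true

/-- `(i, a, b)` is a move of `P_i` (the conjunctive overlay of the pair-processes of `i`)
starting in the current local state `a` of `i`. -/
def IsMove (c : Config G) (i : G.Pid) (a b : LState G i) : Prop :=
  c.LocalIs i a ∧ ∀ e, ∀ he : e ∈ c.pairs, ∀ hi : i ∈ e, ((c.prog e he).arc i hi a b).isSome

/-- `en_i`: some arc of `P_i` is enabled. -/
def Enabled (c : Config G) (i : G.Pid) : Prop :=
  ∃ a b, c.IsMove i a b ∧ ∀ e, ∀ he : e ∈ c.pairs, ∀ hi : i ∈ e,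
    ∃ L, (c.prog e he).arc i hi a b = some L ∧ ∃ g ∈ L, g.guard (c.state e he)

/-- `blk_i`: for some neighbour `j`, the local state of `i` is sometimes-blocking in `M_ij`. -/
def Blocking (c : Config G) (i : G.Pid) : Prop :=
  ∃ e, ∃ he : e ∈ c.pairs, ∃ hi : i ∈ e,
    (c.prog e he).SometimesBlocking i hi ((c.state e he).loc i hi)

/-- `pnd_ij`: the projection of `c` to the pair has a pending eventuality. -/
def Pending (c : Config G) (e : Sym2 G.Pid) : Prop :=
  ∃ he : e ∈ c.pairs, ∃ spec : ACTL (PairAtom G e), (⟨e, spec⟩ : PairSpec G) ∈ c.inForce ∧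
    (c.prog e he).Pending spec (c.state e he)

/-- Active pair-programs induce the same unlabelled skeleton on a common process. -/
def SameGraph (c : Config G) : Prop :=
  ∀ e, ∀ he : e ∈ c.pairs, ∀ e', ∀ he' : e' ∈ c.pairs, ∀ i, ∀ hi : i ∈ e, ∀ hi' : i ∈ e',
    (c.prog e he).node i hi = (c.prog e' he').node i hi' ∧
    ∀ a b, ((c.prog e he).arc i hi a b).isSome = ((c.prog e' he').arc i hi' a b).isSome

/-- The configurations `c`, `d` have the same specifications in force and the same code. -/
def SameCode (c d : Config G) : Prop :=
  c.inForce = d.inForce ∧ ∀ e, ∀ hc : e ∈ c.pairs, ∀ hd : e ∈ d.pairs, c.prog e hc = d.prog e hd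

end Config

/-- Labels of transitions of the synthesized program: a process index, or `create`. -/
inductive Label (G : Sig) where
  | proc : G.Pid → Label G
  | create : Label G

namespace DynSpec

/-- Initial configurations of the synthesized program. -/
def initConfigs (D : DynSpec G) : Set (Config G) :=
  {c | c.inForce = D.initial ∧
    (∀ e, ∀ he : e ∈ c.pairs, c.prog e he ∈ D.supply e ∧ c.state e he ∈ (c.prog e he).start) ∧
    ∀ e, ∀ he : e ∈ c.pairs, ∀ spec : ACTL (PairAtom G e),
      (⟨e, spec⟩ : PairSpec G) ∈ c.inForce → (c.prog e he).Models spec}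

/-- Normal transitions, by process `i`. -/
def NormalTrans (s : Config G) (i : G.Pid) (t : Config G) : Prop :=
  i ∈ s.procs ∧ s.SameCode t ∧
  (∀ e, ∀ hs : e ∈ s.pairs, ∀ ht : e ∈ t.pairs, ∀ hi : i ∈ e,
    ∃ L, (s.prog e hs).arc i hi ((s.state e hs).loc i hi) ((t.state e ht).loc i hi) = some L ∧
      ∃ g ∈ L, g.guard (s.state e hs) ∧ (t.state e ht).sh = g.body.exec (s.state e hs).sh) ∧
  (∀ e, ∀ hs : e ∈ s.pairs, ∀ ht : e ∈ t.pairs, ∀ j, ∀ hj : j ∈ e, j ≠ i →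
    (s.state e hs).loc j hj = (t.state e ht).loc j hj) ∧
  (∀ e, ∀ hs : e ∈ s.pairs, ∀ ht : e ∈ t.pairs, i ∉ e → s.state e hs = t.state e ht)

/-- Create transitions, bringing the pair-specification `σ` into force. -/
def CreateTrans (D : DynSpec G) (σ : PairSpec G) (s t : Config G) : Prop :=
  σ.pair ∉ s.pairs ∧ σ ∈ D.create s.inForce ∧
  t.inForce = insert σ s.inForce ∧
  (∃ ht : σ.pair ∈ t.pairs,
    t.prog σ.pair ht ∈ D.supply σ.pair ∧ (t.prog σ.pair ht).Models σ.spec ∧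
    (t.prog σ.pair ht).Reachable (t.state σ.pair ht) ∧
    ∀ i, ∀ hi : i ∈ σ.pair, ∀ a, s.LocalIs i a → (t.state σ.pair ht).loc i hi = a) ∧
  ∀ e, ∀ hs : e ∈ s.pairs, ∀ ht : e ∈ t.pairs,
    t.prog e ht = s.prog e hs ∧ t.state e ht = s.state e hs

/-- The transitions of the synthesized program `𝒫`. -/
def Trans (D : DynSpec G) (s : Config G) (l : Label G) (t : Config G) : Prop :=
  match l with
  | .proc i => NormalTrans s i t
  | .create => ∃ σ, D.CreateTrans σ s t

/-- Reachable configurations of `M_𝒫`. -/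
def Reachable (D : DynSpec G) (s : Config G) : Prop :=
  ReachableFrom D.Trans D.initConfigs s

end DynSpec

/-! ### Wait-for-graphs, supercycles, the liveness condition -/

/-- Nodes of wait-for-graphs: processes, and moves (of `i`, with start and target state). -/
inductive WNode (G : Sig) where
  | proc : G.Pid → WNode G
  | move : (i : G.Pid) → LState G i → LState G i → WNode G

namespace Config

/-- The nodes of `W(c)`. -/
def InW (c : Config G) : WNode G → Prop
  | .proc i => i ∈ c.procs
  | .move i a b => c.IsMove i a b

/-- The edges of `W(c)`: from a process to each of its moves, and from a move `a_i` to each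
neighbour `j` of `i` such that the conjunct of its guard over the pair `{i, j}` is false. -/
def WEdge (c : Config G) : WNode G → WNode G → Prop
  | .proc i, .move j a b => i = j ∧ c.IsMove j a b
  | .move i a b, .proc j => c.IsMove i a b ∧
      ∃ h : s(i, j) ∈ c.pairs, ∃ L,
        (c.prog s(i, j) h).arc i (Sym2.mem_mk_left i j) a b = some L ∧
        ∀ g ∈ L, ¬ g.guard (c.state s(i, j) h)
  | _, _ => False

/-- The graph with node set `V` and edge set `E` is a supercycle in `W(c)`. -/
structure IsSupercycle (c : Config G) (V : Set (WNode G)) (E : Set (WNode G × WNode G)) :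
    Prop where
  node_sub : ∀ x ∈ V, c.InW x
  edge_sub : ∀ x y, (x, y) ∈ E → x ∈ V ∧ y ∈ V ∧ c.WEdge x y
  nonempty : V.Nonempty
  proc_mem : ∀ i, .proc i ∈ V → ∀ a b, c.IsMove i a b → (.proc i, .move i a b) ∈ E
  move_mem : ∀ i a b, .move i a b ∈ V →
    ∃ j, c.WEdge (.move i a b) (.proc j) ∧ (.move i a b, .proc j) ∈ E

/-- `W(c)` is supercycle-free. -/
def SupercycleFree (c : Config G) : Prop := ∀ V E, ¬ c.IsSupercycle V E

/-- The processes to which there is a path in `W(c)` from a process of the pair `e`. -/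
def WaitSet (c : Config G) (e : Sym2 G.Pid) : Set G.Pid :=
  {k | ∃ i ∈ e, Relation.ReflTransGen c.WEdge (.proc i) (.proc k)}

end Config

namespace DynSpec

/-- `t` is reachable from `s` along a path of `M_𝒫` all of whose configurations
satisfy `pnd_ij`, `e = {i, j}`. -/
def PendingReach (D : DynSpec G) (e : Sym2 G.Pid) (s t : Config G) : Prop :=
  s.Pending e ∧ Relation.ReflTransGen (fun a b => b.Pending e ∧ ∃ l, D.Trans a l b) s t

/-- The liveness condition for dynamic programs. -/
def LivenessCondition (D : DynSpec G) : Prop :=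
  ∀ s, D.Reachable s → ∀ e, ∀ he : e ∈ s.pairs,
    (s.prog e he).LocalLiveness ∧
    (s.Pending e → ∃ W : Set G.Pid, W.Finite ∧ ∀ t, D.PendingReach e s t → t.WaitSet e ⊆ W)

end DynSpec

/-! ### The low-atomicity implementation -/

/-- The objects that can be locked: a shared variable of a pair, or the block of atomic
propositions of a process. -/
inductive Res (G : Sig) where
  | var : (e : Sym2 G.Pid) → G.Sh e → Res G
  | props : G.Pid → Res G

/-- Control state of the procedure `Main(P_i)`, with its private variables.  The moves of `P_i`
from its current local state are identified by their target, and a neighbour `j` of `i` by the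
pair `{i, j}`; `choice` gives the position of a guarded command in a label.

* `main`: in the loop of `Main`, between two invocations of `Execute`;
* `polling X choice`: in `Choose`, running the interleaved `Poll`s of all moves; `X b` are the
  neighbours for which no true guard of the move to `b` has been found yet;
* `waiting b choice`: `Choose` has returned the move to `b`; locks have been requested;
* `holding b choice`: all locks are held;
* `releasing`: the move has been executed, the locks have not yet been released. -/
inductive Ctrl (G : Sig) (i : G.Pid) where
  | main : Ctrl G i
  | polling (X : LState G i → Set (Sym2 G.Pid)) (choice : LState G i → Sym2 G.Pid → ℕ) : Ctrl G i
  | waiting (b : LState G i) (choice : Sym2 G.Pid → ℕ) : Ctrl G i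
  | holding (b : LState G i) (choice : Sym2 G.Pid → ℕ) : Ctrl G i
  | releasing : Ctrl G i

/-- A configuration of the implementation `P_r`: the specifications in force, the code, the
local states and the shared variables (together a `Config`), the control state of every
process, and the locks held by every process. -/
structure LowConfig (G : Sig) where
  cfg : Config G
  ctrl : (i : G.Pid) → Ctrl G i
  held : G.Pid → Set (Res G)

/-- Labels of transitions of `M_r`: a step of process `i` that executes no move (start of
`Execute`, poll of a guard, return of `Choose`, locking, unlocking); the execution of a move
by process `i`; a creation. -/
inductive LowLabel (G : Sig) where
  | aux : G.Pid → LowLabel G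
  | move : G.Pid → LowLabel G
  | create : LowLabel G

/-- The guarded command in position `choice e` of the label, in the active pair-program for the
pair `e`, of the arc of `i` from its current local state to `b`, is `g`. -/
def Config.Chosen (c : Config G) (i : G.Pid) (b : LState G i) (choice : Sym2 G.Pid → ℕ)
    (e : Sym2 G.Pid) (he : e ∈ c.pairs) (g : GCmd G e) : Prop :=
  ∃ hi : i ∈ e, ∃ L, (c.prog e he).arc i hi ((c.state e he).loc i hi) b = some L ∧
    L[choice e]? = some g

/-- What `i` locks to execute its move to `b`: its own atomic propositions, and all variables
assigned by the chosen bodies. -/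
def Config.needs (c : Config G) (i : G.Pid) (b : LState G i) (choice : Sym2 G.Pid → ℕ) :
    Set (Res G) :=
  {r | r = .props i ∨ ∃ e, ∃ he : e ∈ c.pairs, ∃ g, c.Chosen i b choice e he g ∧
    ∃ x : G.Sh e, (g.body x).isSome ∧ r = .var e x}

/-- The effect of a move of `i` to `b`: all chosen assignments are performed, without any
re-evaluation of guards, and the local state of `i` becomes `b`. -/
def Config.ExecMove (s : Config G) (i : G.Pid) (b : LState G i) (choice : Sym2 G.Pid → ℕ)
    (t : Config G) : Prop :=
  s.SameCode t ∧
  (∀ e, ∀ hs : e ∈ s.pairs, ∀ ht : e ∈ t.pairs, ∀ hi : i ∈ e,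
    (t.state e ht).loc i hi = b ∧
    ∃ g, s.Chosen i b choice e hs g ∧ (t.state e ht).sh = g.body.exec (s.state e hs).sh) ∧
  (∀ e, ∀ hs : e ∈ s.pairs, ∀ ht : e ∈ t.pairs, ∀ j, ∀ hj : j ∈ e, j ≠ i →
    (t.state e ht).loc j hj = (s.state e hs).loc j hj) ∧
  (∀ e, ∀ hs : e ∈ s.pairs, ∀ ht : e ∈ t.pairs, i ∉ e → t.state e ht = s.state e hs)

namespace LowConfig

/-- Only the control state of `i` may change from `v` to `w`, and it becomes `q`. -/
def SetCtrl (v : LowConfig G) (i : G.Pid) (q : Ctrl G i) (w : LowConfig G) : Prop :=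
  w.cfg = v.cfg ∧ w.held = v.held ∧ w.ctrl i = q ∧ ∀ k ≠ i, w.ctrl k = v.ctrl k

/-- `Main` invokes `Execute`, which invokes `Choose`, which starts all `Poll`s. -/
def StartStep (v : LowConfig G) (i : G.Pid) (w : LowConfig G) : Prop :=
  i ∈ v.cfg.procs ∧ v.ctrl i = .main ∧
  v.SetCtrl i (.polling (fun _ => v.cfg.nbrs i) (fun _ _ => 0)) w

/-- One guard of one move is polled; if it is true, the neighbour concerned is removed from `X`
and the guard is recorded in `choice`, otherwise nothing changes.  Polling goes on until the
set `X` of some move is empty. -/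
def PollStep (v : LowConfig G) (i : G.Pid) (w : LowConfig G) : Prop :=
  ∃ X choice, v.ctrl i = .polling X choice ∧
    (∀ a b, v.cfg.IsMove i a b → (X b).Nonempty) ∧
    ∃ a b, v.cfg.IsMove i a b ∧ ∃ e ∈ X b, ∃ he : e ∈ v.cfg.pairs, ∃ hi : i ∈ e,
      ∃ L, (v.cfg.prog e he).arc i hi a b = some L ∧
      ∃ (n : ℕ) (g : GCmd G e), L[n]? = some g ∧
        ((g.guard (v.cfg.state e he) ∧
          ∃ X' choice', v.SetCtrl i (.polling X' choice') w ∧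
            X' b = X b \ {e} ∧ (∀ b' ≠ b, X' b' = X b') ∧
            choice' b e = n ∧
            (∀ b' e', ¬ (b' = b ∧ e' = e) → choice' b' e' = choice b' e')) ∨
        (¬ g.guard (v.cfg.state e he) ∧ w = v))

/-- `Choose` returns the move for which `X` has become empty, and the locks are requested. -/
def ChooseStep (v : LowConfig G) (i : G.Pid) (w : LowConfig G) : Prop :=
  ∃ X choice, v.ctrl i = .polling X choice ∧
    ∃ a b, v.cfg.IsMove i a b ∧ X b = ∅ ∧ v.SetCtrl i (.waiting b (choice b)) w

/-- The locks are granted, subject to mutual exclusion (this is the interface that a solution of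
the dining/drinking philosophers problem provides: a thirsty philosopher starts to drink while
no other philosopher drinks from any of the bottles it needs). -/
def LockStep (v : LowConfig G) (i : G.Pid) (w : LowConfig G) : Prop :=
  ∃ b choice, v.ctrl i = .waiting b choice ∧
    (∀ k ≠ i, Disjoint (v.cfg.needs i b choice) (v.held k)) ∧
    w.cfg = v.cfg ∧ w.ctrl i = .holding b choice ∧ (∀ k ≠ i, w.ctrl k = v.ctrl k) ∧
    w.held i = v.cfg.needs i b choice ∧ ∀ k ≠ i, w.held k = v.held k

/-- The chosen move is executed, as one atomic step, under the locks. -/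
def MoveStep (v : LowConfig G) (i : G.Pid) (w : LowConfig G) : Prop :=
  ∃ b choice, v.ctrl i = .holding b choice ∧ v.cfg.ExecMove i b choice w.cfg ∧
    w.held = v.held ∧ w.ctrl i = .releasing ∧ ∀ k ≠ i, w.ctrl k = v.ctrl k

/-- All locks are released, and control returns to `Main`. -/
def ReleaseStep (v : LowConfig G) (i : G.Pid) (w : LowConfig G) : Prop :=
  v.ctrl i = .releasing ∧ w.cfg = v.cfg ∧ w.ctrl i = .main ∧
    (∀ k ≠ i, w.ctrl k = v.ctrl k) ∧ w.held i = ∅ ∧ ∀ k ≠ i, w.held k = v.held k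

/-- A new pair-program is created; those of its two processes that already exist take part, which
they do only between two invocations of `Execute`. -/
def CreateStep (D : DynSpec G) (v w : LowConfig G) : Prop :=
  ∃ σ, D.CreateTrans σ v.cfg w.cfg ∧ (∀ i ∈ σ.pair, i ∈ v.cfg.procs → v.ctrl i = .main) ∧
    w.ctrl = v.ctrl ∧ w.held = v.held

end LowConfig

namespace DynSpec

/-- The transitions of the global state transition diagram `M_r`. -/
def LowTrans (D : DynSpec G) (v : LowConfig G) (l : LowLabel G) (w : LowConfig G) : Prop :=
  match l with
  | .aux i => v.StartStep i w ∨ v.PollStep i w ∨ v.ChooseStep i w ∨ v.LockStep i w ∨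
      v.ReleaseStep i w
  | .move i => v.MoveStep i w
  | .create => LowConfig.CreateStep D v w

/-- The initial configurations of `M_r`. -/
def lowInit (D : DynSpec G) : Set (LowConfig G) :=
  {v | v.cfg ∈ D.initConfigs ∧ (∀ i, v.ctrl i = .main) ∧ ∀ i, v.held i = ∅}

/-- Reachable configurations of `M_r`. -/
def LowReachable (D : DynSpec G) (v : LowConfig G) : Prop :=
  ReachableFrom D.LowTrans D.lowInit v

end DynSpec

/-! ### Fairness and fair satisfaction in `M_r` -/

/-- `ex_i`: the transition executes a move of process `i`. -/
def LowLabel.Ex (i : G.Pid) (l : LowLabel G) : Prop := l = .move i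

/-- `normal`: the transition is by a process, i.e., it is not a creation. -/
def LowLabel.Normal (l : LowLabel G) : Prop := l ≠ .create

/-- Weak blocking fairness: over all processes occurring along `ρ`. -/
def WeakBlockingFair (ρ : Path (LowConfig G) (LowLabel G)) : Prop :=
  ∀ i, (∃ n : ℕ, (n : ℕ∞) ≤ ρ.len ∧ i ∈ (ρ.st n).cfg.procs) →
    ρ.EvAlways (fun v => v.cfg.Blocking i ∧ v.cfg.Enabled i) → ρ.InfOften (LowLabel.Ex i)

/-- Weak eventuality fairness: over all pairs `{i, j}` occurring along `ρ`. -/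
def WeakEventualityFair (ρ : Path (LowConfig G) (LowLabel G)) : Prop :=
  ∀ i j, (∃ n : ℕ, (n : ℕ∞) ≤ ρ.len ∧ s(i, j) ∈ (ρ.st n).cfg.pairs) →
    (ρ.EvAlways (fun v => v.cfg.Enabled i) ∨ ρ.EvAlways (fun v => v.cfg.Enabled j)) →
    ρ.EvAlways (fun v => v.cfg.Pending s(i, j)) →
    ρ.InfOften (fun l => l.Ex i ∨ l.Ex j)

/-- Creation fairness: infinitely many transitions are normal. -/
def CreationFair (ρ : Path (LowConfig G) (LowLabel G)) : Prop :=
  ρ.InfOften LowLabel.Normal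

/-- The fairness notion `Φ`. -/
def Fair (ρ : Path (LowConfig G) (LowLabel G)) : Prop :=
  WeakBlockingFair ρ ∧ WeakEventualityFair ρ ∧ CreationFair ρ

/-- `M_r, u ⊨_Φ f`, for a formula `f` over the propositions of the pair `e`. -/
def DynSpec.FairSat (D : DynSpec G) {e : Sym2 G.Pid} (u : LowConfig G)
    (f : ACTL (PairAtom G e)) : Prop :=
  f.Sat D.LowTrans Fair (fun v a => v.cfg.Holds a.1.1 a.2) u

end DynSynth

/-! The implementation executes a move on guards that were polled earlier. A guard recorded as true
for a process stays true until that process changes its local state (temporary stability), and no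
neighbour is created for it in the meantime. Hence the executing step is a normal transition of the
synthesized program, creations are create transitions, and all other steps leave the configuration
unchanged (`LowInv.step`). A run thus projects to each active pair as a path of its pair-structure
with stuttering (`exists_proj`).

Without nexttime, stuttering is harmless, and formulae transfer by induction (`fairSat_of_sat`). The
until operators are carried along the projection by their one-step unfoldings. The liveness part of
`A[f U g]` needs more. If the pair moves infinitely often, deleting the stuttering gives a fullpath
of the pair-structure, which must meet `g`. Otherwise, if `g` never holds, both processes stop
moving while `g` is a pending eventuality forever.

This last case contradicts fairness (`exists_starving`, `Fair.not_starved`). While the pair is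
pending, its wait set stays inside a finite set. Call a process stuck if it moves only finitely
often. By local liveness a stuck process eventually does not wait for one that moves infinitely
often, so eventually the whole wait set is stuck. Then wait-for edges from it can only disappear,
and the wait set becomes constant. As it spans no supercycle, some process in it has a move without
outgoing edge, and keeps that move enabled forever. This process is in the pair, against weak
eventuality fairness, or is waited for at all later times and so sometimes-blocking, against weak
blocking fairness. -/

namespace DynSynth

variable {S L : Type*}

/-! ### Fullpaths: extension, existence, removal of stuttering -/

namespace Path

/-- The path `s --l--> π`. -/
def cons (s : S) (l : L) (π : Path S L) : Path S L where
  len := π.len + 1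
  st := fun n => n.casesOn s π.st
  lab := fun n => n.casesOn l π.lab

theorem IsFull.cons {tr : S → L → S → Prop} {π : Path S L} (hπ : π.IsFull tr) {s : S} {l : L}
    (h : tr s l (π.st 0)) : (Path.cons s l π).IsFull tr := by
  constructor
  · rintro (_ | n) hn
    · exact h
    · refine hπ.1 n ?_
      have : ((n : ℕ∞) + 1) < π.len + 1 := by exact_mod_cast hn
      exact (ENat.add_lt_add_iff_right (by simp)).1 this
  · rintro (_ | n) hn
    · simp [Path.cons] at hn
    · refine hπ.2 n ?_
      have : π.len + 1 = (n : ℕ∞) + 1 := by exact_mod_cast hn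
      exact WithTop.add_right_cancel ENat.one_ne_top this

/-- Iterate a chosen successor, forever or up to the first dead end. Universal path quantifiers
yield information about a state only through such a path. -/
theorem exists_isFull [Nonempty L] (tr : S → L → S → Prop) (s : S) :
    ∃ π : Path S L, π.IsFull tr ∧ π.st 0 = s := by
  classical
  by_cases hdead : ∃ l t, tr s l t
  · obtain ⟨l0, -⟩ := hdead
    let next : S → S := fun x => if h : ∃ l t, tr x l t then h.choose_spec.choose else x
    let lb : S → L := fun x => if h : ∃ l t, tr x l t then h.choose else l0
    have hnext : ∀ x, (∃ l t, tr x l t) → tr x (lb x) (next x) := by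
      intro x h
      simp only [lb, next, dif_pos h]
      exact h.choose_spec.choose_spec
    let y : ℕ → S := fun n => next^[n] s
    have hy : ∀ n, y (n + 1) = next (y n) := fun n => Function.iterate_succ_apply' _ _ _
    by_cases hall : ∀ n, ∃ l t, tr (y n) l t
    · refine ⟨⟨⊤, y, fun n => lb (y n)⟩, ⟨fun n _ => ?_, fun n hn => ?_⟩, rfl⟩
      · show tr (y n) _ (y (n + 1))
        rw [hy]
        exact hnext _ (hall n)
      · simp at hn
    · push Not at hall
      have hex : ∃ n, ¬ ∃ l t, tr (y n) l t := by
        obtain ⟨n, hn⟩ := hall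
        exact ⟨n, by push Not; exact hn⟩
      refine ⟨⟨(Nat.find hex : ℕ), y, fun n => lb (y n)⟩, ⟨fun n hn => ?_, fun n hn => ?_⟩, rfl⟩
      · have : n < Nat.find hex := Nat.cast_lt.1 hn
        show tr (y n) _ (y (n + 1))
        rw [hy]
        exact hnext _ (not_not.1 (Nat.find_min hex this))
      · have : Nat.find hex = n := Nat.cast_injective hn
        exact this ▸ Nat.find_spec hex
  · exact ⟨⟨0, fun _ => s, fun _ => Classical.arbitrary L⟩,
      ⟨fun n hn => by simp at hn, fun _ _ => hdead⟩, rfl⟩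

/-- Removing the stuttering from an infinite sequence in which infinitely many steps are
transitions. -/
theorem exists_unstutter {tr : S → L → S → Prop} {x : ℕ → S} {lb : ℕ → L} {Q : ℕ → Prop}
    (hQ : ∀ n, Q n → tr (x n) (lb n) (x (n + 1))) (hnQ : ∀ n, ¬ Q n → x (n + 1) = x n)
    (hinf : ∀ n, ∃ m, n ≤ m ∧ Q m) :
    ∃ π : Path S L, π.len = ⊤ ∧ π.IsFull tr ∧ π.st 0 = x 0 ∧
      (∀ n, ∃ m, Q m ∧ π.lab n = lb m ∧ π.st n = x m) ∧
      ∀ n0, ∃ m0, ∀ m, m0 ≤ m → ∃ n, n0 ≤ n ∧ x m = π.st n := by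
  classical
  have hI : (Set.ofPred Q).Infinite := by
    refine Set.infinite_of_forall_exists_gt fun n => ?_
    obtain ⟨m, hm, h⟩ := hinf (n + 1)
    exact ⟨m, h, hm⟩
  have hstut : ∀ a d, (∀ m, a ≤ m → m < a + d → ¬ Q m) → x (a + d) = x a := by
    intro a d
    induction d with
    | zero => intro _; rfl
    | succ d ih =>
      intro h
      rw [← Nat.add_assoc, hnQ _ (h (a + d) (by omega) (by omega))]
      exact ih fun m h1 h2 => h m h1 (by omega)
  -- `Nat.nth Q (Nat.count Q m)` is the first genuine transition at or after `m`; all steps before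
  -- it stutter.
  have hcount : ∀ m, x m = x (Nat.nth Q (Nat.count Q m)) := by
    intro m
    have hle : m ≤ Nat.nth Q (Nat.count Q m) := Nat.le_nth_count hI m
    obtain ⟨d, hd⟩ := Nat.exists_eq_add_of_le hle
    rw [hd]
    refine (hstut m d fun k h1 h2 hk => ?_).symm
    have h3 : Nat.count Q k < Nat.count Q m := by
      rw [← (Nat.nth_strictMono hI).lt_iff_lt, Nat.nth_count hk]
      omega
    exact absurd (Nat.count_monotone Q h1) (by omega)
  refine ⟨⟨⊤, fun n => x (Nat.nth Q n), fun n => lb (Nat.nth Q n)⟩, rfl,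
    ⟨fun n _ => ?_, fun n hn => by simp at hn⟩, ?_, fun n => ?_, fun n0 => ?_⟩
  · have h1 := Nat.nth_mem_of_infinite hI n
    have h2 := hcount (Nat.nth Q n + 1)
    rw [Nat.count_succ, Nat.count_nth_of_infinite hI, if_pos h1] at h2
    show tr (x (Nat.nth Q n)) _ (x (Nat.nth Q (n + 1)))
    rw [← h2]
    exact hQ _ h1
  · have := hcount 0
    rw [Nat.count_zero] at this
    exact this.symm
  · exact ⟨_, Nat.nth_mem_of_infinite hI n, rfl, rfl⟩
  · refine ⟨Nat.nth Q n0, fun m hm => ⟨Nat.count Q m, ?_, hcount m⟩⟩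
    rw [← Nat.count_nth_of_infinite hI n0]
    exact Nat.count_monotone Q hm

end Path

/-! ### Unfolding of the until operators -/

namespace ACTL

variable {α : Type*} {tr : S → L → S → Prop} {val : S → α → Prop}

theorem self_mem_CL (f : ACTL α) : f ∈ f.CL := by
  cases f <;> simp [CL]

theorem CL_trans {f g h : ACTL α} (hfg : f ∈ g.CL) (hgh : g ∈ h.CL) : f ∈ h.CL := by
  induction h with
  | tt | ff | atom | natom =>
    simp only [CL, Set.mem_singleton_iff] at hgh
    subst hgh
    exact hfg
  | and a b iha ihb | or a b iha ihb | AU a b iha ihb | AUw a b iha ihb =>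
    simp only [CL, Set.mem_insert_iff, Set.mem_union] at hgh
    rcases hgh with rfl | hgh | hgh
    · exact hfg
    · exact Set.mem_insert_of_mem _ (Or.inl (iha hgh))
    · exact Set.mem_insert_of_mem _ (Or.inr (ihb hgh))

/-- A fullpath from a successor becomes a fullpath from `s` by `cons`, and trivial fairness admits
it. If `g` fails at `s`, its witness on the longer path is not at position 0 and shifts back by one.
-/
theorem Sat.AU_unfold [Nonempty L] {f g : ACTL α} {s : S} (h : (AU f g).Sat tr (fun _ => True) val s) :
    g.Sat tr (fun _ => True) val s ∨ (f.Sat tr (fun _ => True) val s ∧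
      ∀ l t, tr s l t → (AU f g).Sat tr (fun _ => True) val t) := by
  by_cases hg : g.Sat tr (fun _ => True) val s
  · exact Or.inl hg
  right
  constructor
  · obtain ⟨π, hπ, rfl⟩ := Path.exists_isFull tr s
    obtain ⟨n, -, hgn, hfn⟩ := h π hπ rfl trivial
    rcases n with _ | n
    · exact absurd hgn hg
    · exact hfn 0 (by omega)
  · rintro l t hst π hπ rfl -
    obtain ⟨n, hn, hgn, hfn⟩ := h _ (hπ.cons hst) rfl trivial
    rcases n with _ | n
    · exact absurd hgn hg
    · have : ((n : ℕ∞) + 1) ≤ π.len + 1 := by exact_mod_cast hn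
      exact ⟨n, (ENat.add_le_add_iff_right (by simp)).1 this, hgn,
        fun m hm => hfn (m + 1) (by omega)⟩

theorem Sat.AUw_unfold [Nonempty L] {f g : ACTL α} {s : S} (h : (AUw f g).Sat tr (fun _ => True) val s) :
    g.Sat tr (fun _ => True) val s ∨ (f.Sat tr (fun _ => True) val s ∧
      ∀ l t, tr s l t → (AUw f g).Sat tr (fun _ => True) val t) := by
  by_cases hg : g.Sat tr (fun _ => True) val s
  · exact Or.inl hg
  right
  constructor
  · obtain ⟨π, hπ, rfl⟩ := Path.exists_isFull tr s
    exact h π hπ rfl trivial 0 (by simp) fun m hm => by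
      obtain rfl : m = 0 := by omega
      exact hg
  · rintro l t hst π hπ rfl - n hn hng
    refine h _ (hπ.cons hst) rfl trivial (n + 1) ?_ ?_
    · push_cast
      exact add_le_add_left hn 1
    · rintro (_ | m) hm
      · exact hg
      · exact hng m (by omega)

/-- This turns an until whose goal is not yet reached into a pending eventuality. -/
theorem Sat.AF_of_AU {f g : ACTL α} {s : S} (h : (AU f g).Sat tr (fun _ => True) val s) :
    g.AF.Sat tr (fun _ => True) val s := fun π hπ h0 hf => by
  obtain ⟨n, hn, hg, -⟩ := h π hπ h0 hf
  exact ⟨n, hn, hg, fun _ _ => trivial⟩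

end ACTL
end DynSynth

/-! ### Projection of configurations to pairs -/

namespace DynSynth

variable {G : Sig}

/-- The pair `e` is active in `c`, with active pair-program `P` and current state `s`. -/
def Config.On (c : Config G) (e : Sym2 G.Pid) (P : PairProgram G e) (s : PairState G e) : Prop :=
  ∃ h : e ∈ c.pairs, c.prog e h = P ∧ c.state e h = s

namespace Config

theorem on_self (c : Config G) {e : Sym2 G.Pid} (h : e ∈ c.pairs) :
    c.On e (c.prog e h) (c.state e h) := ⟨h, rfl, rfl⟩

theorem On.state_eq {c : Config G} {e : Sym2 G.Pid} {P P' : PairProgram G e} {s s' : PairState G e}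
    (h : c.On e P s) (h' : c.On e P' s') : s = s' := by
  obtain ⟨_, rfl, rfl⟩ := h
  obtain ⟨_, rfl, rfl⟩ := h'
  rfl

theorem On.localIs_iff {c : Config G} {e : Sym2 G.Pid} {P : PairProgram G e} {s : PairState G e}
    (h : c.On e P s) {i : G.Pid} (hi : i ∈ e) {a : LState G i} :
    c.LocalIs i a ↔ s.loc i hi = a := by
  obtain ⟨he, rfl, rfl⟩ := h
  constructor
  · rintro ⟨e', he', hi', rfl⟩
    exact c.consistent _ _ _ _ _ _ _
  · exact fun h => ⟨e, he, hi, h⟩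

theorem On.holds_iff {c : Config G} {e : Sym2 G.Pid} {P : PairProgram G e} {s : PairState G e}
    (h : c.On e P s) (a : PairAtom G e) : c.Holds a.1.1 a.2 ↔ s.val a := by
  simp [Holds, h.localIs_iff a.1.2, PairState.val]

theorem On.pending_iff {c : Config G} {e : Sym2 G.Pid} {P : PairProgram G e} {s : PairState G e}
    (h : c.On e P s) : c.Pending e ↔
      ∃ spec : ACTL (PairAtom G e), (⟨e, spec⟩ : PairSpec G) ∈ c.inForce ∧ P.Pending spec s := by
  obtain ⟨he, rfl, rfl⟩ := h
  exact ⟨fun ⟨_, h⟩ => h, fun h => ⟨he, h⟩⟩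

end Config

/-- The effect on configurations of a step of the implementation. -/
def DynSpec.CfgStep (D : DynSpec G) (c : Config G) (l : LowLabel G) (d : Config G) : Prop :=
  match l with
  | .aux _ => d = c
  | .move k => D.Trans c (.proc k) d
  | .create => D.Trans c .create d

variable {D : DynSpec G} {c d : Config G} {l : LowLabel G}

theorem DynSpec.Reachable.step (hc : D.Reachable c) {l : Label G} (h : D.Trans c l d) :
    D.Reachable d := by
  obtain ⟨s, hs, h'⟩ := hc
  exact ⟨s, hs, h'.tail ⟨l, h⟩⟩

namespace DynSpec.CfgStep

theorem reachable (h : D.CfgStep c l d) (hc : D.Reachable c) : D.Reachable d := by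
  cases l with
  | aux => exact h ▸ hc
  | move k => exact hc.step (l := .proc k) h
  | create => exact hc.step (l := .create) h

theorem inForce_subset (h : D.CfgStep c l d) : c.inForce ⊆ d.inForce := by
  cases l with
  | aux => rw [show d = c from h]
  | move => rw [h.2.1.1]
  | create =>
    obtain ⟨σ, -, -, h, -⟩ := h
    rw [h]
    exact Set.subset_insert _ _

theorem pairs_subset (h : D.CfgStep c l d) : c.pairs ⊆ d.pairs := fun _ ⟨σ, hσ, h'⟩ =>
  ⟨σ, h.inForce_subset hσ, h'⟩

theorem procs_subset (h : D.CfgStep c l d) : c.procs ⊆ d.procs := fun _ ⟨e, he, hi⟩ =>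
  ⟨e, h.pairs_subset he, hi⟩

/-- A move of a process in `e` acts on `e` through its conjunct over `e`, which is a transition of
the pair-program. Moves by others, creations and auxiliary steps leave an already active pair alone.
-/
theorem on (h : D.CfgStep c l d) {e : Sym2 G.Pid} {P : PairProgram G e} {s : PairState G e}
    (hs : c.On e P s) : ∃ t, d.On e P t ∧
      ((∃ k ∈ e, l = .move k ∧ P.Trans s k t) ∨ ((∀ k ∈ e, l ≠ .move k) ∧ t = s)) := by
  have hd : e ∈ d.pairs := h.pairs_subset hs.1
  obtain ⟨hc, rfl, rfl⟩ := hs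
  cases l with
  | aux k =>
    obtain rfl : d = c := h
    exact ⟨_, d.on_self hc, Or.inr ⟨by simp, rfl⟩⟩
  | move k =>
    obtain ⟨hk, hcode, hmove, hother, hstay⟩ := h
    refine ⟨_, ⟨hd, (hcode.2 e hc hd).symm, rfl⟩, ?_⟩
    by_cases hke : k ∈ e
    · exact Or.inl ⟨k, hke, rfl, hke, hmove e hc hd hke,
        fun q hq hqk => (hother e hc hd q hq hqk).symm⟩
    · refine Or.inr ⟨?_, (hstay e hc hd hke).symm⟩
      rintro q hq ⟨⟩
      exact hke hq
  | create =>
    obtain ⟨σ, -, -, -, -, hold⟩ := h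
    exact ⟨_, ⟨hd, (hold e hc hd).1, rfl⟩, Or.inr ⟨by simp, (hold e hc hd).2⟩⟩

end DynSpec.CfgStep

theorem DynSpec.Trans.cfgStep {k : Label G} (h : D.Trans c k d) : ∃ l, D.CfgStep c l d := by
  cases k with
  | proc k => exact ⟨.move k, h⟩
  | create => exact ⟨.create, h⟩

namespace PairProgram

variable {e : Sym2 G.Pid} {P : PairProgram G e} {s t : PairState G e} {k : G.Pid}

theorem Reachable.step (hs : P.Reachable s) (h : P.Trans s k t) : P.Reachable t := by
  obtain ⟨s0, h0, h'⟩ := hs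
  exact ⟨s0, h0, h'.tail ⟨k, h⟩⟩

/-- A step of the other process does not falsify a true guard. -/
theorem TemporarilyStable.guard (hP : P.TemporarilyStable) (hs : P.Reachable s)
    (h : P.Trans s k t) {p : G.Pid} (hp : p ∈ e) (hpk : p ≠ k) {b : LState G p}
    {L : List (GCmd G e)} (hL : P.arc p hp (s.loc p hp) b = some L) {g : GCmd G e} (hg : g ∈ L)
    (hgs : g.guard s) : g.guard t := by
  have : Nonempty G.Pid := ⟨k⟩
  -- Stability speaks of fullpaths, so the transition is completed to one and read at position 1.
  -- The release condition fails at positions 0 and 1, since the local state of `p` has not changed.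
  obtain ⟨π, hπ, h0⟩ := Path.exists_isFull P.Trans t
  have hloc : t.loc p hp = s.loc p hp := h.2.2 p hp hpk
  have := hP p hp _ b L hL g hg s hs ⟨rfl, hgs⟩ _ (hπ.cons (by rw [h0]; exact h)) rfl 1
    (by simp [Path.cons]) ?_
  · have h1 : (Path.cons s k π).st 1 = t := h0
    rw [h1] at this
    exact this.2
  · intro m hm
    have : m = 0 ∨ m = 1 := by omega
    rcases this with rfl | rfl
    · simp [Path.cons]
    · have h1 : (Path.cons s k π).st 1 = t := h0
      rw [h1]
      simpa using hloc

end PairProgram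

namespace DynSpec.Reachable

theorem inForce_subset_univ (hc : D.Reachable c) : c.inForce ⊆ D.univ := by
  obtain ⟨s, hs, h⟩ := hc
  induction h with
  | refl => rw [hs.1]; exact D.initial_sub
  | tail _ h ih =>
    obtain ⟨l, h⟩ := h
    cases l with
    | proc => rwa [← h.2.1.1]
    | create =>
      obtain ⟨σ, -, hσ, h, -⟩ := h
      rw [h]
      exact Set.insert_subset (D.create_sub _ ih hσ) ih

/-- Used to see that a process never waits for itself. -/
theorem not_isDiag (hc : D.Reachable c) {e : Sym2 G.Pid} (he : e ∈ c.pairs) : ¬ e.IsDiag := by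
  obtain ⟨σ, hσ, rfl⟩ := he
  exact D.univ_ne σ (hc.inForce_subset_univ hσ)

/-- An active pair evolves by transitions of its own program, and a new pair is created in a
reachable state of its program. -/
theorem pair_reachable (hc : D.Reachable c) {e : Sym2 G.Pid} {P : PairProgram G e}
    {s : PairState G e} (h : c.On e P s) : P.Reachable s := by
  obtain ⟨c0, h0, hr⟩ := hc
  induction hr generalizing P s with
  | refl =>
    obtain ⟨he, rfl, rfl⟩ := h
    exact ⟨_, (h0.2.1 e he).2, .refl⟩
  | @tail c d _ hcd ih =>
    by_cases hec : e ∈ c.pairs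
    · obtain ⟨l, hl⟩ := hcd
      obtain ⟨l', hl'⟩ := hl.cfgStep
      obtain ⟨t, ht, hst⟩ := hl'.on (c.on_self hec)
      obtain rfl := ht.state_eq h
      obtain ⟨hd, hP, ht⟩ := ht
      obtain ⟨_, hP', _⟩ := h
      rw [← hP', hP]
      rcases hst with ⟨k, _, _, hk⟩ | ⟨_, hs⟩
      · exact (ih (c.on_self hec)).step hk
      · exact hs ▸ ih (c.on_self hec)
    · obtain ⟨he, rfl, rfl⟩ := h
      obtain ⟨l, hl⟩ := hcd
      cases l with
      | proc =>
        exact absurd (by rw [Config.pairs, hl.2.1.1]; exact he) hec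
      | create =>
        obtain ⟨σ, -, -, hin, ⟨_, _, _, hr, _⟩, -⟩ := hl
        have : σ.pair = e := by
          obtain ⟨τ, hτ, rfl⟩ := he
          rw [hin] at hτ
          rcases hτ with rfl | hτ
          · rfl
          · exact absurd ⟨τ, hτ, rfl⟩ hec
        subst this
        exact hr

end DynSpec.Reachable

/-- The standing assumption of temporary stability on the active pair-programs. -/
def DynSpec.Stable (D : DynSpec G) : Prop :=
  ∀ c, D.Reachable c → ∀ e, ∀ he : e ∈ c.pairs, (c.prog e he).TemporarilyStable

/-- Stability lifted from pair-programs to configurations. Both the persistence of recorded guards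
and the disappearance of wait-for edges rest on it. -/
theorem DynSpec.CfgStep.on_guard (hD : D.Stable) (hc : D.Reachable c) (h : D.CfgStep c l d)
    {e : Sym2 G.Pid} {P : PairProgram G e} {s t : PairState G e} (hs : c.On e P s)
    (ht : d.On e P t) {p : G.Pid} (hp : p ∈ e) (hl : l ≠ .move p) :
    t.loc p hp = s.loc p hp ∧ ∀ b L, P.arc p hp (s.loc p hp) b = some L → ∀ g ∈ L,
      g.guard s → g.guard t := by
  obtain ⟨t', ht', hst⟩ := h.on hs
  obtain rfl := ht'.state_eq ht
  rcases hst with ⟨k, hk, rfl, hst⟩ | ⟨_, rfl⟩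
  · have hpk : p ≠ k := by rintro rfl; exact hl rfl
    refine ⟨hst.2.2 p hp hpk, fun b L hL g hg hgs => ?_⟩
    have hPs : P.TemporarilyStable := by
      obtain ⟨he, rfl, rfl⟩ := hs
      exact hD c hc e he
    exact hPs.guard (hc.pair_reachable hs) hst hp hpk hL hg hgs
  · exact ⟨rfl, fun _ _ _ _ _ h => h⟩

/-! ### The invariant of the implementation -/

/-- The chosen guarded command of the move of `i` to `b` over the pair `e` is enabled. -/
def Config.Ready (c : Config G) (i : G.Pid) (b : LState G i) (choice : Sym2 G.Pid → ℕ)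
    (e : Sym2 G.Pid) : Prop :=
  ∃ he g, c.Chosen i b choice e he g ∧ g.guard (c.state e he)

theorem Config.ready_congr {i : G.Pid} {b : LState G i} {choice choice' : Sym2 G.Pid → ℕ}
    {e : Sym2 G.Pid} (h : choice e = choice' e) (hr : c.Ready i b choice e) :
    c.Ready i b choice' e := by
  obtain ⟨he, g, ⟨hi, L, hL, hn⟩, hg⟩ := hr
  exact ⟨he, g, ⟨hi, L, hL, h ▸ hn⟩, hg⟩

theorem DynSpec.CfgStep.ready (hD : D.Stable) (hc : D.Reachable c) (h : D.CfgStep c l d)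
    {i : G.Pid} (hl : l ≠ .move i) {b : LState G i} {choice : Sym2 G.Pid → ℕ} {e : Sym2 G.Pid}
    (hr : c.Ready i b choice e) : d.Ready i b choice e := by
  obtain ⟨he, g, ⟨hi, L, hL, hn⟩, hg⟩ := hr
  obtain ⟨t, ht, -⟩ := h.on (c.on_self he)
  obtain ⟨hloc, hgd⟩ := h.on_guard hD hc (c.on_self he) ht hi hl
  have hgt := hgd b L hL g (List.mem_of_getElem? hn) hg
  obtain ⟨hd, hP, rfl⟩ := ht
  exact ⟨hd, g, ⟨hi, L, by rw [hP, hloc]; exact hL, hn⟩, hgt⟩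

/-- The guards recorded in the control state of `i` are true. -/
def Config.CtrlInv (c : Config G) (i : G.Pid) : Ctrl G i → Prop
  | .main => True
  | .polling X choice => i ∈ c.procs ∧ ∀ b, ∀ e ∈ c.nbrs i, e ∉ X b → c.Ready i b (choice b) e
  | .waiting b choice => i ∈ c.procs ∧ ∀ e ∈ c.nbrs i, c.Ready i b choice e
  | .holding b choice => i ∈ c.procs ∧ ∀ e ∈ c.nbrs i, c.Ready i b choice e
  | .releasing => True

/-- Recorded guards survive by stability. A new neighbour would require a guard that was never
polled; the hypothesis on `nbrs` excludes this. -/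
theorem DynSpec.CfgStep.ctrlInv (hD : D.Stable) (hc : D.Reachable c) (h : D.CfgStep c l d)
    {i : G.Pid} (hl : l ≠ .move i) (hn : d.nbrs i ⊆ c.nbrs i) {q : Ctrl G i}
    (hq : c.CtrlInv i q) : d.CtrlInv i q := by
  cases q with
  | main | releasing => trivial
  | polling X choice =>
    exact ⟨h.procs_subset hq.1, fun b e he hX => h.ready hD hc hl (hq.2 b e (hn he) hX)⟩
  | waiting b choice | holding b choice =>
    exact ⟨h.procs_subset hq.1, fun e he => h.ready hD hc hl (hq.2 e (hn he))⟩

/-- `ExecMove` does not look at guards; `Ready` supplies them. Both refer to the same position in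
the same label, so the executed command is the one whose guard is true. -/
theorem Config.ExecMove.normalTrans {i : G.Pid} {b : LState G i} {choice : Sym2 G.Pid → ℕ}
    (h : c.ExecMove i b choice d) (hi : i ∈ c.procs)
    (hr : ∀ e ∈ c.nbrs i, c.Ready i b choice e) : DynSpec.NormalTrans c i d := by
  obtain ⟨hcode, hmove, hother, hstay⟩ := h
  refine ⟨hi, hcode, fun e hs ht hie => ?_, fun e hs ht j hj hji => (hother e hs ht j hj hji).symm,
    fun e hs ht hie => (hstay e hs ht hie).symm⟩
  obtain ⟨hb, g, ⟨_, L, hL, hg⟩, hsh⟩ := hmove e hs ht hie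
  obtain ⟨_, g', ⟨_, L', hL', hg'⟩, hguard⟩ := hr e ⟨hs, hie⟩
  obtain rfl : L = L' := Option.some.inj (hL.symm.trans hL')
  obtain rfl : g = g' := Option.some.inj (hg.symm.trans hg')
  exact ⟨L, by rw [hb]; exact hL, g, List.mem_of_getElem? hg, hguard, hsh⟩

/-- The invariant of the implementation. -/
def DynSpec.LowInv (D : DynSpec G) (v : LowConfig G) : Prop :=
  D.Reachable v.cfg ∧ ∀ i, v.cfg.CtrlInv i (v.ctrl i)

theorem DynSpec.LowInv.of_ctrl {v w : LowConfig G} {i : G.Pid} {q : Ctrl G i} (hv : D.LowInv v)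
    (hcfg : w.cfg = v.cfg) (hi : w.ctrl i = q) (hk : ∀ k ≠ i, w.ctrl k = v.ctrl k)
    (hq : v.cfg.CtrlInv i q) : D.LowInv w ∧ w.cfg = v.cfg := by
  refine ⟨⟨hcfg ▸ hv.1, fun k => ?_⟩, hcfg⟩
  rw [hcfg]
  by_cases hki : k = i
  · subst hki
    rwa [hi]
  · rw [hk k hki]
    exact hv.2 k

theorem LowConfig.SetCtrl.inv {v w : LowConfig G} {i : G.Pid} {q : Ctrl G i}
    (h : v.SetCtrl i q w) (hv : D.LowInv v) (hq : v.cfg.CtrlInv i q) :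
    D.LowInv w ∧ w.cfg = v.cfg :=
  hv.of_ctrl h.1 h.2.2.1 h.2.2.2 hq

theorem DynSpec.LowInv.aux {v w : LowConfig G} {i : G.Pid} (hv : D.LowInv v)
    (h : D.LowTrans v (.aux i) w) : D.LowInv w ∧ w.cfg = v.cfg := by
  have hvi := hv.2 i
  rcases h with h | h | h | h | h
  · obtain ⟨hi, -, h⟩ := h
    exact h.inv hv ⟨hi, fun b e he hX => absurd he hX⟩
  · obtain ⟨X, choice, hctrl, -, a, b, hab, e, heX, he, hi, L, hL, n, g, hg, h⟩ := h
    rw [hctrl] at hvi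
    rcases h with ⟨hguard, X', choice', h, hX, hX', hch, hch'⟩ | ⟨-, rfl⟩
    · refine h.inv hv ⟨hvi.1, fun b' e' he' heX' => ?_⟩
      by_cases hbe : b' = b ∧ e' = e
      · obtain ⟨rfl, rfl⟩ := hbe
        have ha : (v.cfg.state e' he).loc i hi = a := ((v.cfg.on_self he).localIs_iff hi).1 hab.1
        exact ⟨he, g, ⟨hi, L, by rw [ha]; exact hL, by rw [hch]; exact hg⟩, hguard⟩
      -- The poll alters `X` and `choice` only at the entry `(b, e)`, so any other entry was already
      -- recorded before.
      · refine Config.ready_congr (hch' b' e' hbe).symm (hvi.2 b' e' he' fun hmem => heX' ?_)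
        by_cases hb : b' = b
        · subst hb
          rw [hX]
          exact ⟨hmem, fun h => hbe ⟨rfl, h⟩⟩
        · rwa [hX' b' hb]
    · exact ⟨hv, rfl⟩
  · obtain ⟨X, choice, hctrl, a, b, hab, hX, h⟩ := h
    rw [hctrl] at hvi
    exact h.inv hv ⟨hvi.1, fun e he => hvi.2 b e he (by simp [hX])⟩
  · obtain ⟨b, choice, hctrl, -, hcfg, hq, hk, -⟩ := h
    rw [hctrl] at hvi
    exact hv.of_ctrl hcfg hq hk hvi
  · obtain ⟨-, hcfg, hq, hk, -⟩ := h
    exact hv.of_ctrl hcfg hq hk trivial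

theorem DynSpec.LowInv.step (hD : D.Stable) {v w : LowConfig G} {l : LowLabel G}
    (hv : D.LowInv v) (h : D.LowTrans v l w) : D.LowInv w ∧ D.CfgStep v.cfg l w.cfg := by
  cases l with
  | aux i => exact hv.aux h
  | move i =>
    obtain ⟨b, choice, hctrl, hexec, -, hi, hk⟩ := h
    have hvi := hv.2 i
    rw [hctrl] at hvi
    have hstep : D.CfgStep v.cfg (.move i) w.cfg := hexec.normalTrans hvi.1 hvi.2
    refine ⟨⟨hstep.reachable hv.1, fun k => ?_⟩, hstep⟩
    by_cases hki : k = i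
    · subst hki
      rw [hi]
      trivial
    · rw [hk k hki]
      refine hstep.ctrlInv hD hv.1 (by rintro ⟨⟩; exact hki rfl) ?_ (hv.2 k)
      rw [Config.nbrs, Config.nbrs, Config.pairs, Config.pairs, hexec.1.1]
  | create =>
    obtain ⟨σ, hcr, hmain, hctrl, -⟩ := h
    have hstep : D.CfgStep v.cfg .create w.cfg := ⟨σ, hcr⟩
    refine ⟨⟨hstep.reachable hv.1, fun k => ?_⟩, hstep⟩
    rw [hctrl]
    have hvk := hv.2 k
    by_cases hkσ : k ∈ σ.pair ∧ k ∈ v.cfg.procs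
    · rw [hmain k hkσ.1 hkσ.2]
      trivial
    by_cases hk : k ∈ v.cfg.procs
    · refine hstep.ctrlInv hD hv.1 (by simp) ?_ hvk
      rintro e ⟨⟨τ, hτ, rfl⟩, hke⟩
      rw [hcr.2.2.1] at hτ
      rcases hτ with rfl | hτ
      · exact absurd ⟨hke, hk⟩ hkσ
      · exact ⟨⟨τ, hτ, rfl⟩, hke⟩
    -- A process that does not exist yet cannot be inside a round with recorded guards: `CtrlInv`
    -- includes existence in those control states for this purpose.
    · cases hq : v.ctrl k with
      | main | releasing => trivial
      | polling | waiting | holding =>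
        rw [hq] at hvk
        exact absurd hvk.1 hk

theorem DynSpec.LowReachable.inv (hD : D.Stable) {v : LowConfig G} (hv : D.LowReachable v) :
    D.LowInv v := by
  obtain ⟨v0, h0, h⟩ := hv
  induction h with
  | refl =>
    refine ⟨⟨_, h0.1, .refl⟩, fun i => ?_⟩
    rw [h0.2.1 i]
    trivial
  | tail _ h ih =>
    obtain ⟨l, h⟩ := h
    exact (ih.step hD h).1

end DynSynth

namespace DynSynth

open Filter

variable {G : Sig} {D : DynSpec G} {c d : Config G} {l : LowLabel G}

/-! ### Waiting -/

/-- Some move of `k` is blocked by `k'`. -/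
def Config.Waits (c : Config G) (k k' : G.Pid) : Prop :=
  ∃ a b, c.WEdge (.move k a b) (.proc k')

namespace Config

/-- Paths of the wait-for-graph alternate between processes and moves. Identifying each move with
its owner contracts them to chains of `Waits`. -/
theorem mem_waitSet_iff {e : Sym2 G.Pid} {k : G.Pid} :
    k ∈ c.WaitSet e ↔ ∃ i ∈ e, Relation.ReflTransGen c.Waits i k := by
  refine exists_congr fun i => and_congr_right fun _ => ⟨fun h => ?_, fun h => ?_⟩
  · let motive : WNode G → Prop := fun y => match y with
      | .proc k => Relation.ReflTransGen c.Waits i k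
      | .move k _ _ => Relation.ReflTransGen c.Waits i k
    suffices ∀ y, Relation.ReflTransGen c.WEdge (.proc i) y → motive y from this _ h
    intro y hy
    induction hy with
    | refl => exact .refl
    | @tail y z _ hyz ih =>
      cases y with
      | proc k =>
        cases z with
        | proc => exact hyz.elim
        | move k' a b => obtain ⟨rfl, -⟩ := hyz; exact ih
      | move k a b =>
        cases z with
        | proc k' => exact Relation.ReflTransGen.tail ih ⟨a, b, hyz⟩
        | move => exact hyz.elim
  · induction h with
    | refl => exact .refl
    | tail _ h ih =>
      obtain ⟨a, b, h⟩ := h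
      exact (ih.tail (b := .proc _) (c := .move _ a b) ⟨rfl, h.1⟩).tail h

theorem waitSet_step {e : Sym2 G.Pid} {k k' : G.Pid} (hk : k ∈ c.WaitSet e) (h : c.Waits k k') :
    k' ∈ c.WaitSet e := by
  obtain ⟨i, hi, hik⟩ := mem_waitSet_iff.1 hk
  exact mem_waitSet_iff.2 ⟨i, hi, hik.tail h⟩

theorem waitSet_subset_procs {e : Sym2 G.Pid} (he : e ∈ c.pairs) :
    c.WaitSet e ⊆ c.procs := by
  intro k hk
  obtain ⟨i, hi, hik⟩ := mem_waitSet_iff.1 hk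
  cases hik.cases_tail with
  | inl h => exact ⟨e, he, h ▸ hi⟩
  | inr h =>
    obtain ⟨k', -, a, b, -, hp, -⟩ := h
    exact ⟨_, hp, Sym2.mem_mk_right k' k⟩

theorem wEdge_iff {k k' : G.Pid} {a b : LState G k} {P : PairProgram G s(k, k')}
    {s : PairState G s(k, k')} (h : c.On s(k, k') P s) :
    c.WEdge (.move k a b) (.proc k') ↔ c.IsMove k a b ∧
      ∃ L, P.arc k (Sym2.mem_mk_left k k') a b = some L ∧ ∀ g ∈ L, ¬ g.guard s := by
  obtain ⟨he, rfl, rfl⟩ := h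
  exact ⟨fun ⟨h, _, h'⟩ => ⟨h, h'⟩, fun ⟨h, h'⟩ => ⟨h, he, h'⟩⟩

theorem enabled_of_forall_not_wEdge {k : G.Pid} {a b : LState G k} (h : c.IsMove k a b)
    (hw : ∀ k', ¬ c.WEdge (.move k a b) (.proc k')) : c.Enabled k := by
  refine ⟨a, b, h, fun e he hi => ?_⟩
  obtain ⟨L, hL⟩ := Option.isSome_iff_exists.1 (h.2 e he hi)
  refine ⟨L, hL, ?_⟩
  obtain ⟨k', rfl⟩ := Sym2.mem_iff_exists.1 hi
  by_contra hcon
  push Not at hcon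
  exact hw k' ⟨h, he, L, hL, hcon⟩

/-- The current state of the pair is itself a reachable state in which an arc of `k'` is blocked. -/
theorem blocking_of_waits (hc : D.Reachable c) {k k' : G.Pid} (h : c.Waits k' k) :
    c.Blocking k := by
  obtain ⟨a, b, hm, he, L, hL, hg⟩ := h
  refine ⟨s(k', k), he, Sym2.mem_mk_right k' k, _, hc.pair_reachable (c.on_self he), rfl, k',
    Sym2.mem_mk_left k' k, ?_, b, L, ?_, hg⟩
  · exact fun h => hc.not_isDiag he h
  · rwa [((c.on_self he).localIs_iff (Sym2.mem_mk_left k' k)).1 hm.1]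

end Config

namespace DynSpec.CfgStep

theorem isMove_back (h : D.CfgStep c l d) (hD : D.Stable) (hc : D.Reachable c)
    {k : G.Pid} (hl : l ≠ .move k) (hk : k ∈ c.procs) {a b : LState G k} (hm : d.IsMove k a b) :
    c.IsMove k a b := by
  obtain ⟨e, he, hke⟩ := hk
  obtain ⟨t, ht, -⟩ := h.on (c.on_self he)
  refine ⟨((c.on_self he).localIs_iff hke).2 ?_, fun e' he' hke' => ?_⟩
  · rw [← (h.on_guard hD hc (c.on_self he) ht hke hl).1]
    exact (ht.localIs_iff hke).1 hm.1
  · obtain ⟨t', ⟨hd', hP, -⟩, -⟩ := h.on (c.on_self he')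
    rw [← hP]
    exact hm.2 e' hd' hke'

/-- A new neighbour adds a conjunct and could destroy the move; the common skeleton guarantees the
arc in the new pair-program too. -/
theorem isMove (h : D.CfgStep c l d) (hD : D.Stable) (hc : D.Reachable c) (hd : d.SameGraph)
    {k : G.Pid} (hl : l ≠ .move k) {a b : LState G k} (hm : c.IsMove k a b) :
    d.IsMove k a b := by
  obtain ⟨⟨e, he, hke, hloc⟩, hm⟩ := hm
  obtain ⟨t, ht, -⟩ := h.on (c.on_self he)
  refine ⟨(ht.localIs_iff hke).2 ?_, fun e' he' hke' => ?_⟩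
  · rw [(h.on_guard hD hc (c.on_self he) ht hke hl).1, hloc]
  · obtain ⟨hde, hP, -⟩ := ht
    rw [← (hd e hde e' he' k hke hke').2 a b, hP]
    exact hm e he hke

/-- As long as `k` does not move, an old neighbour does not become blocking. -/
theorem wEdge_back (h : D.CfgStep c l d) (hD : D.Stable) (hc : D.Reachable c)
    {k k' : G.Pid} (hl : l ≠ .move k) (hp : s(k, k') ∈ c.pairs) {a b : LState G k}
    (hw : d.WEdge (.move k a b) (.proc k')) : c.WEdge (.move k a b) (.proc k') := by
  have hkk : k ∈ s(k, k') := Sym2.mem_mk_left k k'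
  obtain ⟨t, ht, -⟩ := h.on (c.on_self hp)
  obtain ⟨hm, L, hL, hg⟩ := (Config.wEdge_iff ht).1 hw
  have hm' := h.isMove_back hD hc hl ⟨_, hp, hkk⟩ hm
  refine (Config.wEdge_iff (c.on_self hp)).2 ⟨hm', L, hL, fun g hgL hgs => hg g hgL ?_⟩
  refine (h.on_guard hD hc (c.on_self hp) ht hkk hl).2 b L ?_ g hgL hgs
  rwa [((c.on_self hp).localIs_iff hkk).1 hm'.1]

end DynSpec.CfgStep

/-! ### Infinite runs -/

/-- An infinite sequence of configurations along a path of the implementation. -/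
structure DynSpec.Run (D : DynSpec G) (c : ℕ → Config G) (lab : ℕ → LowLabel G) : Prop where
  reachable : ∀ n, D.Reachable (c n)
  step : ∀ n, D.CfgStep (c n) (lab n) (c (n + 1))

namespace DynSpec.Run

variable {c : ℕ → Config G} {lab : ℕ → LowLabel G}

theorem shift (h : D.Run c lab) (N : ℕ) : D.Run (fun n => c (n + N)) (fun n => lab (n + N)) where
  reachable n := h.reachable _
  step n := by
    show D.CfgStep (c (n + N)) (lab (n + N)) (c (n + 1 + N))
    rw [show n + 1 + N = n + N + 1 by omega]
    exact h.step (n + N)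

theorem inForce_mono (h : D.Run c lab) : Monotone fun n => (c n).inForce :=
  monotone_nat_of_le_succ fun n => (h.step n).inForce_subset

theorem pairs_mono (h : D.Run c lab) : Monotone fun n => (c n).pairs :=
  monotone_nat_of_le_succ fun n => (h.step n).pairs_subset

/-- The projection of a run to a pair. -/
theorem exists_proj (h : D.Run c lab) {e : Sym2 G.Pid} {P : PairProgram G e} {s : PairState G e}
    (hs : (c 0).On e P s) : ∃ x : ℕ → PairState G e, x 0 = s ∧ (∀ n, (c n).On e P (x n)) ∧
      ∀ n, (∃ k ∈ e, lab n = .move k ∧ P.Trans (x n) k (x (n + 1))) ∨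
        ((∀ k ∈ e, lab n ≠ .move k) ∧ x (n + 1) = x n) := by
  have hon : ∀ n, ∃ t, (c n).On e P t := by
    intro n
    induction n with
    | zero => exact ⟨s, hs⟩
    | succ n ih =>
      obtain ⟨t, ht⟩ := ih
      obtain ⟨t', ht', -⟩ := (h.step n).on ht
      exact ⟨t', ht'⟩
  choose x hx using hon
  refine ⟨x, (hx 0).state_eq hs, hx, fun n => ?_⟩
  obtain ⟨t, ht, hstep⟩ := (h.step n).on (hx n)
  rwa [ht.state_eq (hx (n + 1))] at hstep

/-- If moves of the pair are executed infinitely often, the projection without stuttering is an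
infinite fullpath of the pair-structure. -/
theorem exists_path {e : Sym2 G.Pid} {P : PairProgram G e} {x : ℕ → PairState G e}
    (hx : ∀ n, (∃ k ∈ e, lab n = .move k ∧ P.Trans (x n) k (x (n + 1))) ∨
      ((∀ k ∈ e, lab n ≠ .move k) ∧ x (n + 1) = x n))
    (hinf : ∀ n, ∃ m, n ≤ m ∧ ∃ k ∈ e, lab m = .move k) :
    ∃ π : Path (PairState G e) G.Pid, π.len = ⊤ ∧ π.IsFull P.Trans ∧ π.st 0 = x 0 ∧
      (∀ n, ∃ m, (π.lab n ∈ e ∧ lab m = .move (π.lab n)) ∧ π.st n = x m) ∧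
      ∀ n0, ∃ m0, ∀ m, m0 ≤ m → ∃ n, n0 ≤ n ∧ x m = π.st n := by
  classical
  have hne : ∃ k : G.Pid, k ∈ e := by
    obtain ⟨_, _, k, hk, _⟩ := hinf 0
    exact ⟨k, hk⟩
  let lb : ℕ → G.Pid := fun n => if h : ∃ k ∈ e, lab n = .move k then h.choose else hne.choose
  have hlb : ∀ n, (∃ k ∈ e, lab n = .move k) → lb n ∈ e ∧ lab n = .move (lb n) := by
    intro n hn
    simp only [lb, dif_pos hn]
    exact hn.choose_spec
  have htr : ∀ n, (∃ k ∈ e, lab n = .move k) → P.Trans (x n) (lb n) (x (n + 1)) := by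
    intro n hn
    obtain ⟨k, hk, hlk, ht⟩ | ⟨hno, -⟩ := hx n
    · have := (hlb n hn).2
      rw [hlk] at this
      obtain rfl : k = lb n := by injection this
      exact ht
    · obtain ⟨k, hk, h⟩ := hn
      exact absurd h (hno k hk)
  have hstut : ∀ n, (¬ ∃ k ∈ e, lab n = .move k) → x (n + 1) = x n := by
    intro n hn
    obtain ⟨k, hk, hlk, -⟩ | ⟨-, h⟩ := hx n
    · exact absurd ⟨k, hk, hlk⟩ hn
    · exact h
  obtain ⟨π, h1, h2, h3, h4, h5⟩ := Path.exists_unstutter htr hstut hinf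
  refine ⟨π, h1, h2, h3, fun n => ?_, h5⟩
  obtain ⟨m, hm, hl, hs⟩ := h4 n
  exact ⟨m, hl ▸ hlb m hm, hs⟩

/-- A process that moves infinitely often eventually does not block one that does not move. -/
theorem eventually_not_waits (h : D.Run c lab) (hlive : D.LivenessCondition) {k k' : G.Pid}
    (hk : ∀ᶠ n in atTop, lab n ≠ .move k) (hk' : ¬ ∀ᶠ n in atTop, lab n ≠ .move k') :
    ∀ᶠ n in atTop, ¬ (c n).Waits k k' := by
  by_cases hp : ∃ n, s(k, k') ∈ (c n).pairs
  swap
  · push Not at hp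
    exact .of_forall fun n ⟨_, _, _, h, _⟩ => hp n h
  obtain ⟨n0, hp⟩ := hp
  obtain ⟨n1, hn1⟩ := eventually_atTop.1 hk
  set N := max n0 n1
  have hpN : s(k, k') ∈ (c (0 + N)).pairs := h.pairs_mono (by omega) hp
  have hkk : k ∈ s(k, k') := Sym2.mem_mk_left k k'
  have hkk' : k' ∈ s(k, k') := Sym2.mem_mk_right k k'
  have hmem : ∀ p ∈ s(k, k'), p = k ∨ p = k' := fun p hp => Sym2.mem_iff.1 hp
  have hne : k ≠ k' := fun h' => (h.reachable (0 + N)).not_isDiag hpN h'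
  have hR := h.shift N
  obtain ⟨x, hx0, hon, hx⟩ := hR.exists_proj (Config.on_self (c (0 + N)) hpN)
  have hinf : ∀ n, ∃ m, n ≤ m ∧ ∃ p ∈ s(k, k'), lab (m + N) = .move p := by
    intro n
    rw [not_eventually] at hk'
    obtain ⟨m, hm, hlm⟩ := frequently_atTop.1 hk' (n + N)
    exact ⟨m - N, by omega, k', hkk', by rw [Nat.sub_add_cancel (by omega)]; exact not_not.1 hlm⟩
  -- After `N` the pair exists and `k` no longer moves, so all transitions of this infinite path are
  -- by `k'`. Local liveness then makes every arc of `k` over the pair eventually enabled.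
  obtain ⟨π, hlen, hfull, h0, hst, htail⟩ := exists_path hx hinf
  obtain ⟨n2, -, hn2⟩ := (hlive _ (h.reachable (0 + N)) _ hpN).1 k' hkk' k hkk hne _
    ((h.reachable (0 + N)).pair_reachable (Config.on_self _ hpN)) π hfull (h0.trans hx0)
    fun n _ => by
      obtain ⟨m, ⟨hl1, hl2⟩, -⟩ := hst n
      refine ⟨by simp [hlen], (hmem _ hl1).resolve_left fun hk0 => ?_⟩
      rw [hk0] at hl2
      exact hn1 (m + N) (by omega) hl2
  obtain ⟨m0, hm0⟩ := htail n2
  refine eventually_atTop.2 ⟨m0 + N, fun m hm ⟨a, b, hw⟩ => ?_⟩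
  obtain ⟨n, hn, hxn⟩ := hm0 (m - N) (by omega)
  have hall := hn2 n hn (by simp [hlen])
  rw [← hxn] at hall
  have honm := hon (m - N)
  simp only [Nat.sub_add_cancel (show N ≤ m by omega)] at honm
  obtain ⟨hmv, L, hL, hg⟩ := (Config.wEdge_iff honm).1 hw
  rw [← (honm.localIs_iff hkk).1 hmv.1] at hL
  obtain ⟨g, hgL, hgx⟩ := hall b L hL
  exact hg g hgL hgx

/-- If the processes of a pending pair never move, then some process that eventually never moves
is eventually always enabled, and it belongs to the pair or is eventually always
sometimes-blocking. -/
theorem exists_starving (h : D.Run c lab) (hD : D.Stable)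
    (hgraph : ∀ c, D.Reachable c → c.SameGraph) (hlive : D.LivenessCondition)
    (hfree : ∀ n, (c n).SupercycleFree) {e : Sym2 G.Pid} (hpend : ∀ n, (c n).Pending e)
    (hstay : ∀ n, ∀ k ∈ e, lab n ≠ .move k) :
    ∃ k, (∃ n, k ∈ (c n).procs) ∧ (∀ᶠ n in atTop, lab n ≠ .move k) ∧
      (∀ᶠ n in atTop, (c n).Enabled k) ∧ (k ∈ e ∨ ∀ᶠ n in atTop, (c n).Blocking k) := by
  have hpairs : ∀ n, e ∈ (c n).pairs := fun n => (hpend n).1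
  obtain ⟨W, hWfin, hW⟩ := (hlive _ (h.reachable 0) e (hpairs 0)).2 (hpend 0)
  -- The run is a path of the synthesized program up to auxiliary steps, and it is pending
  -- throughout, so the bound for the first configuration serves for all.
  replace hW : ∀ n, (c n).WaitSet e ⊆ W := by
    intro n
    refine hW _ ⟨hpend 0, ?_⟩
    induction n with
    | zero => exact .refl
    | succ n ih =>
      have hs := h.step n
      cases hl : lab n with
      | aux =>
        rw [hl] at hs
        rw [show c (n + 1) = c n from hs]
        exact ih
      | move k => rw [hl] at hs; exact ih.tail ⟨hpend _, .proc k, hs⟩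
      | create => rw [hl] at hs; exact ih.tail ⟨hpend _, .create, hs⟩
  let Stuck : G.Pid → Prop := fun k => ∀ᶠ n in atTop, lab n ≠ .move k
  -- Finiteness of `W` makes the thresholds uniform, here and in `hB`, `hC` and `hV`.
  have hA : ∀ᶠ n in atTop, ∀ k ∈ W, Stuck k → lab n ≠ .move k := by
    rw [eventually_all_finite hWfin]
    intro k _
    by_cases hk : Stuck k
    · exact hk.mono fun n hn _ => hn
    · exact .of_forall fun n h => absurd h hk
  have hB : ∀ᶠ n in atTop, ∀ k ∈ W, ∀ k' ∈ W,
      (∃ m, s(k, k') ∈ (c m).pairs) → s(k, k') ∈ (c n).pairs := by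
    rw [eventually_all_finite hWfin]
    intro k _
    rw [eventually_all_finite hWfin]
    intro k' _
    by_cases hk : ∃ m, s(k, k') ∈ (c m).pairs
    · obtain ⟨m, hm⟩ := hk
      exact eventually_atTop.2 ⟨m, fun n hn _ => h.pairs_mono hn hm⟩
    · exact .of_forall fun n h => absurd h hk
  have hC : ∀ᶠ n in atTop, ∀ k ∈ W, ∀ k' ∈ W, Stuck k → ¬ Stuck k' → ¬ (c n).Waits k k' := by
    rw [eventually_all_finite hWfin]
    intro k _
    rw [eventually_all_finite hWfin]
    intro k' _
    by_cases hk : Stuck k ∧ ¬ Stuck k'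
    · exact (h.eventually_not_waits hlive hk.1 hk.2).mono fun n hn _ _ => hn
    · exact .of_forall fun n h1 h2 => absurd ⟨h1, h2⟩ hk
  obtain ⟨N, hN⟩ := eventually_atTop.1 (hA.and (hB.and hC))
  have hstuck : ∀ n, N ≤ n → ∀ k ∈ (c n).WaitSet e, Stuck k := by
    intro n hn k hk
    obtain ⟨i, hi, hik⟩ := Config.mem_waitSet_iff.1 hk
    clear hk
    induction hik with
    | refl => exact .of_forall fun n => hstay n i hi
    | @tail k k' hik hkk' ih =>
      have hkW := hW n (Config.mem_waitSet_iff.2 ⟨i, hi, hik⟩)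
      have hkW' := hW n (Config.mem_waitSet_iff.2 ⟨i, hi, hik.tail hkk'⟩)
      by_contra hcon
      exact (hN n hn).2.2 k hkW k' hkW' ih hcon hkk'
  -- edges from waiting processes do not appear anew
  have hback : ∀ n, N ≤ n → ∀ k ∈ (c (n + 1)).WaitSet e, ∀ a b k',
      (c (n + 1)).WEdge (.move k a b) (.proc k') → (c n).WEdge (.move k a b) (.proc k') := by
    intro n hn k hk a b k' hw
    have hkW := hW _ hk
    have hkW' := hW _ (Config.waitSet_step hk ⟨a, b, hw⟩)
    obtain ⟨hnA, hnB, -⟩ := hN n hn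
    refine (h.step n).wEdge_back hD (h.reachable n) ?_ (hnB k hkW k' hkW' ⟨_, hw.2.1⟩) hw
    exact hnA k hkW (hstuck _ (by omega) k hk)
  have hanti : ∀ n, N ≤ n → (c (n + 1)).WaitSet e ⊆ (c n).WaitSet e := by
    intro n hn k hk
    obtain ⟨i, hi, hik⟩ := Config.mem_waitSet_iff.1 hk
    clear hk
    refine Config.mem_waitSet_iff.2 ⟨i, hi, ?_⟩
    induction hik with
    | refl => exact .refl
    | @tail k k' hik hkk' ih =>
      obtain ⟨a, b, hw⟩ := hkk'
      exact ih.tail ⟨a, b, hback n hn k (Config.mem_waitSet_iff.2 ⟨i, hi, hik⟩) a b k' hw⟩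
  have hanti' : ∀ n m, N ≤ n → n ≤ m → (c m).WaitSet e ⊆ (c n).WaitSet e := by
    intro n m hn hnm
    induction hnm with
    | refl => exact subset_rfl
    | step hnm ih => exact (hanti _ (hn.trans hnm)).trans ih
  let V : Set G.Pid := {k | ∀ n, N ≤ n → k ∈ (c n).WaitSet e}
  have hV : ∀ᶠ n in atTop, ∀ k ∈ W, k ∈ (c n).WaitSet e → k ∈ V := by
    rw [eventually_all_finite hWfin]
    intro k _
    by_cases hk : k ∈ V
    · exact .of_forall fun _ _ => hk
    · simp only [V, Set.mem_ofPred_eq, not_forall] at hk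
      obtain ⟨n, hn, hkn⟩ := hk
      exact eventually_atTop.2 ⟨n, fun m hm hkm => absurd (hanti' n m hn hm hkm) hkn⟩
  obtain ⟨M, hM⟩ := eventually_atTop.1 (hV.and (eventually_ge_atTop N))
  have hMV : ∀ n, M ≤ n → ∀ k, k ∈ (c n).WaitSet e ↔ k ∈ V := fun n hn k =>
    ⟨fun hk => (hM n hn).1 k (hW n hk) hk, fun hk => hk n (hM n hn).2⟩
  have hfreeM : ∃ k ∈ V, ∃ a b, (c M).IsMove k a b ∧ ∀ k', ¬ (c M).WEdge (.move k a b) (.proc k') := by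
    by_contra hcon
    push Not at hcon
    let nodes : Set (WNode G) := {y | match y with
      | .proc k => k ∈ V
      | .move k a b => k ∈ V ∧ (c M).IsMove k a b}
    refine hfree M nodes {p | p.1 ∈ nodes ∧ p.2 ∈ nodes ∧ (c M).WEdge p.1 p.2}
      ⟨?_, fun x y h => h, ?_, ?_, ?_⟩
    · rintro (k | ⟨k, a, b⟩) hk
      · exact Config.waitSet_subset_procs (hpairs M) ((hMV M le_rfl k).2 hk)
      · exact hk.2
    · obtain ⟨i, hi⟩ : ∃ i, i ∈ e := by
        induction e with
        | _ i j => exact ⟨i, Sym2.mem_mk_left i j⟩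
      exact ⟨.proc i, (hMV M le_rfl i).1 (Config.mem_waitSet_iff.2 ⟨i, hi, .refl⟩)⟩
    · exact fun k hk a b hab => ⟨hk, ⟨hk, hab⟩, rfl, hab⟩
    · rintro k a b ⟨hk, hab⟩
      obtain ⟨k', hw⟩ := hcon k hk a b hab
      refine ⟨k', hw, ⟨hk, hab⟩, ?_, hw⟩
      exact (hMV M le_rfl k').1 (Config.waitSet_step ((hMV M le_rfl k).2 hk) ⟨a, b, hw⟩)
  obtain ⟨k, hkV, a, b, hab, hnw⟩ := hfreeM
  have hkS : Stuck k := hstuck M (hM M le_rfl).2 k ((hMV M le_rfl k).2 hkV)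
  have hkW : k ∈ W := hW M ((hMV M le_rfl k).2 hkV)
  have hen : ∀ n, M ≤ n → (c n).IsMove k a b ∧ ∀ k', ¬ (c n).WEdge (.move k a b) (.proc k') := by
    intro n hn
    induction hn with
    | refl => exact ⟨hab, hnw⟩
    | @step n hn ih =>
      have hNn := (hM n hn).2
      refine ⟨(h.step n).isMove hD (h.reachable n) (hgraph _ (h.reachable _))
        ((hN n hNn).1 k hkW hkS) ih.1, fun k' hw => ih.2 k' ?_⟩
      exact hback n hNn k (hkV _ (by omega)) a b k' hw
  refine ⟨k, ⟨M, Config.waitSet_subset_procs (hpairs M) ((hMV M le_rfl k).2 hkV)⟩, hkS,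
    eventually_atTop.2 ⟨M, fun n hn =>
      Config.enabled_of_forall_not_wEdge (hen n hn).1 (hen n hn).2⟩, ?_⟩
  by_cases hke : k ∈ e
  · exact Or.inl hke
  · refine Or.inr (eventually_atTop.2 ⟨M, fun n hn => ?_⟩)
    obtain ⟨i, hi, hik⟩ := Config.mem_waitSet_iff.1 ((hMV n hn k).2 hkV)
    cases hik.cases_tail with
    | inl h => exact absurd (h ▸ hi) hke
    | inr h' =>
      obtain ⟨k', -, hw⟩ := h'
      exact Config.blocking_of_waits (h.reachable n) hw

end DynSpec.Run
end DynSynth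

/-! ### Fairness and the transfer of formulae -/

namespace DynSynth

open Filter

variable {G : Sig} {D : DynSpec G}

namespace Path

variable {S L : Type*} {π : Path S L}

theorem evAlways_of_eventually {N : ℕ} (hπ : π.len = ⊤) {q : S → Prop}
    (h : ∀ᶠ n in atTop, q (π.st (n + N))) : π.EvAlways q := by
  obtain ⟨n, hn⟩ := eventually_atTop.1 h
  refine ⟨n + N, by simp [hπ], fun m hm _ => ?_⟩
  have := hn (m - N) (by omega)
  rwa [Nat.sub_add_cancel (by omega)] at this

theorem not_infOften_of_eventually {N : ℕ} {q : L → Prop}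
    (h : ∀ᶠ n in atTop, ¬ q (π.lab (n + N))) : ¬ π.InfOften q := fun hinf => by
  obtain ⟨n, hn⟩ := eventually_atTop.1 h
  obtain ⟨m, hm, -, hq⟩ := hinf (n + N)
  refine hn (m - N) (by omega) ?_
  rwa [Nat.sub_add_cancel (by omega)]

/-- Through creation fairness, every fair path is infinite. -/
theorem InfOften.len_eq_top {q : L → Prop} (h : π.InfOften q) : π.len = ⊤ := by
  refine ENat.eq_top_iff_forall_ge.2 fun n => ?_
  obtain ⟨m, hm, hlt, -⟩ := h n
  exact le_trans (by exact_mod_cast hm) hlt.le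

end Path

/-- A fair path is not pending at `e` forever while the processes of `e` do not move. -/
theorem Fair.not_starved {ρ : Path (LowConfig G) (LowLabel G)} (hfair : Fair ρ) (hD : D.Stable)
    (hgraph : ∀ c, D.Reachable c → c.SameGraph) (hlive : D.LivenessCondition)
    (hfree : ∀ n, (ρ.st n).cfg.SupercycleFree)
    (hrun : D.Run (fun n => (ρ.st n).cfg) ρ.lab) {e : Sym2 G.Pid} {N : ℕ}
    (hpend : ∀ n, (ρ.st (n + N)).cfg.Pending e) (hstay : ∀ n, ∀ k ∈ e, ρ.lab (n + N) ≠ .move k) :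
    False := by
  obtain ⟨hblk, hev, hcr⟩ := hfair
  have hlen := hcr.len_eq_top
  obtain ⟨k, ⟨n, hkn⟩, hstuck, hen, h⟩ :=
    (hrun.shift N).exists_starving hD hgraph hlive (fun n => hfree _) hpend hstay
  rcases h with hke | hbl
  · obtain ⟨j, rfl⟩ := Sym2.mem_iff_exists.1 hke
    refine Path.not_infOften_of_eventually (N := N) (.of_forall fun n => ?_)
      (hev k j ⟨N, by simp [hlen], ?_⟩ (Or.inl (Path.evAlways_of_eventually hlen hen))
        (Path.evAlways_of_eventually (N := N) hlen (.of_forall hpend)))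
    · rintro (h | h)
      · exact hstay n k (Sym2.mem_mk_left k j) h
      · exact hstay n j (Sym2.mem_mk_right k j) h
    · have := (hpend 0).1
      rwa [Nat.zero_add] at this
  · exact Path.not_infOften_of_eventually hstuck
      (hblk k ⟨n + N, by simp [hlen], hkn⟩ (Path.evAlways_of_eventually hlen (hbl.and hen)))

/-- Transfer of satisfaction from the pair-structure to the implementation. -/
theorem DynSpec.fairSat_of_sat (hD : D.Stable) (hgraph : ∀ c, D.Reachable c → c.SameGraph)
    (hlive : D.LivenessCondition) (hfree : ∀ v, D.LowReachable v → v.cfg.SupercycleFree)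
    {e : Sym2 G.Pid} {spec : ACTL (PairAtom G e)} (f : ACTL (PairAtom G e)) (hf : f ∈ spec.CL)
    {u : LowConfig G} (hu : D.LowReachable u) (hin : (⟨e, spec⟩ : PairSpec G) ∈ u.cfg.inForce)
    {P : PairProgram G e} {s : PairState G e} (hs : u.cfg.On e P s) (hsat : P.Sat s f) :
    D.FairSat u f := by
  have hrun : ∀ {ρ : Path (LowConfig G) (LowLabel G)}, ρ.IsFull D.LowTrans → D.LowReachable (ρ.st 0) →
      Fair ρ → (∀ n, D.LowReachable (ρ.st n)) ∧ D.Run (fun n => (ρ.st n).cfg) ρ.lab := by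
    intro ρ hρ h0 hfair
    have hlen : ρ.len = ⊤ := hfair.2.2.len_eq_top
    have htr : ∀ n, D.LowTrans (ρ.st n) (ρ.lab n) (ρ.st (n + 1)) := fun n =>
      hρ.1 n (by simp [hlen])
    have hr : ∀ n, D.LowReachable (ρ.st n) := by
      intro n
      induction n with
      | zero => exact h0
      | succ n ih =>
        obtain ⟨v, hv, h⟩ := ih
        exact ⟨v, hv, h.tail ⟨_, htr n⟩⟩
    exact ⟨hr, fun n => ((hr n).inv hD).1, fun n => (((hr n).inv hD).step hD (htr n)).2⟩
  have : Nonempty G.Pid := by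
    induction e with
    | _ i j => exact ⟨i⟩
  induction f generalizing u s with
  | tt => trivial
  | ff => exact hsat
  | atom a => exact (hs.holds_iff a).2 hsat
  | natom a => exact fun h => hsat ((hs.holds_iff a).1 h)
  | and f g ihf ihg =>
    exact ⟨ihf (ACTL.CL_trans (by simp [ACTL.CL, ACTL.self_mem_CL]) hf) hu hin hs hsat.1,
      ihg (ACTL.CL_trans (by simp [ACTL.CL, ACTL.self_mem_CL]) hf) hu hin hs hsat.2⟩
  | or f g ihf ihg =>
    exact hsat.imp (ihf (ACTL.CL_trans (by simp [ACTL.CL, ACTL.self_mem_CL]) hf) hu hin hs)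
      (ihg (ACTL.CL_trans (by simp [ACTL.CL, ACTL.self_mem_CL]) hf) hu hin hs)
  | AUw f g ihf ihg =>
    have hfCL : f ∈ spec.CL := ACTL.CL_trans (by simp [ACTL.CL, ACTL.self_mem_CL]) hf
    have hgCL : g ∈ spec.CL := ACTL.CL_trans (by simp [ACTL.CL, ACTL.self_mem_CL]) hf
    rintro ρ hρ rfl hfair n - hng
    obtain ⟨hr, hR⟩ := hrun hρ hu hfair
    obtain ⟨x, rfl, hon, hx⟩ := hR.exists_proj hs
    have hinn : ∀ m, (⟨e, spec⟩ : PairSpec G) ∈ (ρ.st m).cfg.inForce := fun m =>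
      hR.inForce_mono (Nat.zero_le m) hin
    -- Transfer runs only from the pair to the implementation; absence of `g` comes back by
    -- contraposition.
    have hng' : ∀ m ≤ n, ¬ P.Sat (x m) g := fun m hm hg =>
      hng m hm (ihg hgCL (hr m) (hinn m) (hon m) hg)
    have key : ∀ m ≤ n, P.Sat (x m) (f.AUw g) := by
      intro m hm
      induction m with
      | zero => exact hsat
      | succ m ih =>
        rcases hx m with ⟨k, -, -, ht⟩ | ⟨-, h⟩
        · exact ((ACTL.Sat.AUw_unfold (ih (by omega))).resolve_left (hng' m (by omega))).2 k _ ht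
        · rw [h]
          exact ih (by omega)
    exact ihf hfCL (hr n) (hinn n) (hon n)
      ((ACTL.Sat.AUw_unfold (key n le_rfl)).resolve_left (hng' n le_rfl)).1
  | AU f g ihf ihg =>
    have hfCL : f ∈ spec.CL := ACTL.CL_trans (by simp [ACTL.CL, ACTL.self_mem_CL]) hf
    have hgCL : g ∈ spec.CL := ACTL.CL_trans (by simp [ACTL.CL, ACTL.self_mem_CL]) hf
    rintro ρ hρ rfl hfair
    obtain ⟨hr, hR⟩ := hrun hρ hu hfair
    obtain ⟨x, rfl, hon, hx⟩ := hR.exists_proj hs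
    have hinn : ∀ m, (⟨e, spec⟩ : PairSpec G) ∈ (ρ.st m).cfg.inForce := fun m =>
      hR.inForce_mono (Nat.zero_le m) hin
    have key : ∀ m, (∀ m' < m, ¬ P.Sat (x m') g) → P.Sat (x m) (f.AU g) := by
      intro m hm
      induction m with
      | zero => exact hsat
      | succ m ih =>
        have ih' := ih fun m' hm' => hm m' (by omega)
        rcases hx m with ⟨k, -, -, ht⟩ | ⟨-, h⟩
        · exact ((ACTL.Sat.AU_unfold ih').resolve_left (hm m (by omega))).2 k _ ht
        · rwa [h]
    have hex : ∃ m, P.Sat (x m) g := by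
      by_contra hcon
      push Not at hcon
      -- The goal `g` is itself the pending subformula: false at every projected state, yet
      -- inevitable because the until persists.
      have hpend : ∀ m, (ρ.st m).cfg.Pending e := fun m =>
        (hon m).pending_iff.2 ⟨spec, hinn m, g, hgCL, hcon m,
          ACTL.Sat.AF_of_AU (key m fun m' _ => hcon m')⟩
      by_cases hinf : ∀ n, ∃ m, n ≤ m ∧ ∃ k ∈ e, ρ.lab m = .move k
      · obtain ⟨π, -, hfull, h0, hst, -⟩ := DynSpec.Run.exists_path hx hinf
        obtain ⟨n, -, hg, -⟩ := hsat π hfull h0 trivial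
        obtain ⟨m, -, hm⟩ := hst n
        rw [hm] at hg
        exact hcon m hg
      · push Not at hinf
        obtain ⟨N, hN⟩ := hinf
        exact hfair.not_starved hD hgraph hlive (fun n => hfree _ (hr n)) hR
          (N := N) (fun n => hpend _) fun n => hN _ (by omega)
    classical
    -- At the first position with `g` in the projection, all earlier ones satisfy `f` by unfolding
    -- the persisting until.
    have hmin := fun m (hm : m < Nat.find hex) => Nat.find_min hex hm
    refine ⟨Nat.find hex, by simp [hfair.2.2.len_eq_top],
      ihg hgCL (hr _) (hinn _) (hon _) (Nat.find_spec hex), fun m hm => ?_⟩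
    exact ihf hfCL (hr m) (hinn m) (hon m) ((ACTL.Sat.AU_unfold
      (key m fun m' hm' => hmin m' (by omega))).resolve_left (hmin m hm)).1

end DynSynth

theorem mainTheorem9 (G : DynSynth.Sig) (D : DynSynth.DynSpec G)
    (hgraph : ∀ c, D.Reachable c → c.SameGraph)
    (hstab : ∀ c, D.Reachable c → ∀ e, ∀ he : e ∈ c.pairs, (c.prog e he).TemporarilyStable)
    (hlive : D.LivenessCondition)
    (hfree : ∀ v, D.LowReachable v → v.cfg.SupercycleFree)
    (i j : G.Pid) (spec : DynSynth.ACTL (DynSynth.PairAtom G s(i, j)))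
    (u : DynSynth.LowConfig G) (hu : D.LowReachable u)
    (hin : (⟨s(i, j), spec⟩ : DynSynth.PairSpec G) ∈ u.cfg.inForce)
    (f : DynSynth.ACTL (DynSynth.PairAtom G s(i, j))) (hf : f ∈ spec.CL)
    (he : s(i, j) ∈ u.cfg.pairs)
    (hsat : (u.cfg.prog s(i, j) he).Sat (u.cfg.state s(i, j) he) f) :
    D.FairSat u f :=
  DynSynth.DynSpec.fairSat_of_sat hstab hgraph hlive hfree f hf hu hin (u.cfg.on_self he) hsat
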